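/- **Setting.** Let $\mathcal X$ be a finite nonempty set of actions, $k$ a positive semidefinite kernel on $\mathcal X$ with $k(\cdot,\cdot)\le 1$ and RKHS $\mathcal H_k$, and $\mathbb k((x,x'),(u,u'))=k(x,u)+k(x',u')-k(x,u')-k(x',u)$ the dueling kernel on $\mathcal X\times\mathcal X$, with RKHS $\mathcal H_{\mathbb k}$. Let $\mu(s)=(1+e^{-s})^{-1}$. The unknown utility $f\in\mathcal H_k$ satisfies $\|f\|_{\mathcal H_k}\le B$ with $B>0$; $x^\star$ maximizes $f$, and $h(x,x')=f(x)-f(x')$. At each step $t=1,\dots,T$ a pair $(x_t,x'_t)$ is selected and, given the past, a feedback $y_t\in\{0,1\}$ with $\mathbb P(y_t=1)=\mathbb P(x_t\succ x_t')=\mu(h(x_t,x'_t))$ is observed. The regret is $R(T)=\sum_{t=1}^T\frac12\big(\mathbb P(x^\star\succ x_t)+\mathbb P(x^\star\succ x'_t)-1\big)$, where $\mathbb P(x\succ x')=\mu(f(x)-f(x'))$. Put $\kappa=\max_{x,x'}1/\dot\mu(h(x,x'))$, $L=\max_{x,x'}\dot\mu(h(x,x'))$, $\kappa_1=\kappa$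 and $\kappa_r=6$ for $r\ge2$, and let $\lambda>0$, $\delta\in(0,1)$. For $\rho>0$ let $\Gamma_\rho(T)=\max\frac12\log\det(I+\rho^{-1}\mathbb K_T)$, the maximum being over all sequences of $T$ pairs, with $\mathbb K_T$ their $\mathbb k$-Gram matrix. **Algorithm (MR-LPF).** The horizon is divided into rounds of lengths $N_1=\lceil\sqrt T\rceil$, $N_r=\lceil\sqrt{N_{r-1}T}\rceil$, the last one, $N_R$, being cut so that $\sum_{r=1}^R N_r=T$. Put $$\beta_{(r)}(\delta)=L\Big(B+\sqrt{\tfrac{\kappa_r}{\lambda}\log\tfrac{2R|\mathcal X|}{\delta}}\Big).$$ Start with $\mathcal M_1=\mathcal X$. In round $r$, the $n$-th pair maximizes over $\mathcal M_r\times\mathcal M_r$ the uncertainty $\sigma_{(n-1,r)}$, where, from the first $m$ pairs of the round, $$\sigma_{(m,r)}^2(w)=\mathbb k(w,w)-\mathbb k_m(w)^\top(\mathbb K_m+\lambda\kappa_r I)^{-1}\mathbb k_m(w);$$ ties are broken arbitrarily, but without using the feedback of the current round. At the end of the round, $h_{(N_r,r)}$ is the minimizer over $g\in\mathcal H_{\mathbb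 k}$ of the logistic loss of the data of the round, $\sum_i\big(-y_i\log\mu(g(z_i))-(1-y_i)\log(1-\mu(g(z_i)))\big)+\frac\lambda2\|g\|^2_{\mathcal H_{\mathbb k}}$, and $\mathcal M_{r+1}$ is the set of all $x\in\mathcal M_r$ such that $\mu(h_{(N_r,r)}(x,x'))+\beta_{(r)}(\delta)\sigma_{(N_r,r)}(x,x')\ge\frac12$ for all $x'\in\mathcal M_r$. **Theorem (regret bound for MR-LPF).** There is a constant $T_0>0$, depending only on $\mathcal X,k,B,\lambda,\delta$ (not on $T$, nor on $f$ or the run), such that for every $f$ as above and every $T\ge T_0$ the number of rounds satisfies $R\le\lceil\log_2\log_2T\rceil+1$, and, for every run of MR-LPF, with probability at least $1-\delta$, $$R(T)\le 2CR\,\beta_{(R)}(\delta)\sqrt{\Gamma_{4\lambda}(T)}\,\big(\sqrt T+1\big),\qquad C=2\sqrt{\frac{2}{\log(1+4(6\lambda)^{-1})}}.$$ Moreover, for $T\ge T_0$, the right-hand side is at most $C\big(B+\sqrt{6/\lambda}\big)\sqrt{\log(2|\mathcal X|/\delta)}\,\log T\,\sqrt{\Gamma_{4\lambda}(T)\,T}$.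 So the bound is $\tilde O(\sqrt{\Gamma_{4\lambda}(T)\,T})$, with a constant that does not involve $\kappa$. -/

import Mathlib

open MeasureTheory

noncomputable section

namespace BOHF

/-! ### Kernels, reproducing kernel Hilbert spaces, dueling kernel -/

/-- `k` is the reproducing kernel of the (real, scalar-valued) RKHS `H` of functions on `S`. -/
def HasKernel {S : Type*} (H : Type*) [NormedAddCommGroup H] [InnerProductSpace ℝ H]
    [CompleteSpace H] [RKHS ℝ H S ℝ] (k : S → S → ℝ) : Prop :=
  ∀ x y : S, RKHS.kernel H x y 1 = k x y

/-- The dueling kernel on pairs of actions induced by a kernel `k` on actions. -/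
def duelingKernel {X : Type*} (k : X → X → ℝ) (z w : X × X) : ℝ :=
  k z.1 w.1 + k z.2 w.2 - k z.1 w.2 - k z.2 w.1

/-- Matrix of values of the kernel `q` at the points `zs`. -/
def gram {S : Type*} (q : S → S → ℝ) {n : ℕ} (zs : Fin n → S) : Matrix (Fin n) (Fin n) ℝ :=
  Matrix.of fun i j => q (zs i) (zs j)

/-- Vector of values of the kernel `q` between `w` and the points `zs`. -/
def kvec {S : Type*} (q : S → S → ℝ) {n : ℕ} (zs : Fin n → S) (w : S) : Fin n → ℝ :=
  fun i => q w (zs i)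

/-- Uncertainty estimate `σ(w)` from the points `zs`, with regularization `ρ`:
`σ(w)² = q(w,w) - q(w)ᵀ (K + ρ I)⁻¹ q(w)`. -/
def sigma {S : Type*} (q : S → S → ℝ) (ρ : ℝ) {n : ℕ} (zs : Fin n → S) (w : S) : ℝ :=
  √(q w w - kvec q zs w ⬝ᵥ ((gram q zs + ρ • (1 : Matrix (Fin n) (Fin n) ℝ))⁻¹.mulVec
    (kvec q zs w)))

/-- Maximum information gain of the kernel `q` for `T` observations, with regularization `ρ`. -/
def infoGain {S : Type*} (q : S → S → ℝ) (ρ : ℝ) (T : ℕ) : ℝ :=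
  ⨆ zs : Fin T → S, (1 / 2 : ℝ) * Real.log (1 + ρ⁻¹ • gram q zs).det

/-! ### Bradley–Terry–Luce preferences -/

/-- Probability that `x` is preferred over `x'` when the utility function is `f`. -/
def prefProb {X : Type*} (f : X → ℝ) (x x' : X) : ℝ := Real.sigmoid (f x - f x')

/-- `κ = sup 1 / μ'(f x - f x')`, where `μ` is the sigmoid. -/
def kappa {X : Type*} (f : X → ℝ) : ℝ :=
  ⨆ p : X × X, 1 / deriv Real.sigmoid (f p.1 - f p.2)

/-- `L = max μ'(f x - f x')`. -/
def lipConst {X : Type*} (f : X → ℝ) : ℝ :=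
  ⨆ p : X × X, deriv Real.sigmoid (f p.1 - f p.2)

/-- Regularized negative log-likelihood of an element `g` of an RKHS `D`, on the points `zs` with
the binary labels `ys`. -/
def logisticLoss {S : Type*} {D : Type*} [NormedAddCommGroup D] [InnerProductSpace ℝ D]
    [RKHS ℝ D S ℝ] (lam : ℝ) {n : ℕ} (zs : Fin n → S) (ys : Fin n → Bool) (g : D) : ℝ :=
  (∑ i, (-(if ys i then 1 else 0) * Real.log (Real.sigmoid (g (zs i)))
      - (1 - (if ys i then 1 else 0)) * Real.log (1 - Real.sigmoid (g (zs i)))))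
    + lam / 2 * ‖g‖ ^ 2

/-! ### Rounds: lengths, number, confidence widths. Rounds are numbered from `1`. -/

/-- Nominal round lengths: `N₁ = ⌈√T⌉`, `N_{r+1} = ⌈√(N_r T)⌉` (and `0` for the index `0`). -/
def fullLen (T : ℕ) : ℕ → ℕ
  | 0 => 0
  | 1 => ⌈√(T : ℝ)⌉₊
  | r + 2 => ⌈√((fullLen T (r + 1) : ℝ) * (T : ℝ))⌉₊

/-- The number of time steps before round `r`, i.e. `N₁ + ⋯ + N_{r-1}`, capped at `T`. -/
def roundStart (T r : ℕ) : ℕ := min T (∑ j ∈ Finset.range r, fullLen T j)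

/-- Actual round lengths: the last round is cut so that the lengths add up to `T`. -/
def roundLen (T r : ℕ) : ℕ := min (fullLen T r) (T - roundStart T r)

/-- The number of rounds needed for `T` steps. -/
def numRounds (T : ℕ) : ℕ := sInf {R : ℕ | T ≤ ∑ j ∈ Finset.range (R + 1), fullLen T j}

/-- `κ₁ = κ`, and `κ_r = 6` for `r ≥ 2`. -/
def kappaRound {X : Type*} (f : X → ℝ) (r : ℕ) : ℝ := if r ≤ 1 then kappa f else 6

/-- The width `β_(r)(δ) = L (B + √((κ_r / λ) log (2 R |X| / δ)))`. -/
def beta {X : Type*} [Fintype X] (f : X → ℝ) (B lam δ : ℝ) (T r : ℕ) : ℝ :=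
  lipConst f * (B + √(kappaRound f r / lam *
    Real.log (2 * (numRounds T : ℝ) * (Fintype.card X : ℝ) / δ)))

/-- The first `n` entries of round `r` of the time-indexed sequence `s`. -/
def roundData {S : Type*} (T r n : ℕ) (s : ℕ → S) : Fin n → S := fun i => s (roundStart T r + i)

/-! ### The algorithm, interacting with the preference feedback -/

/-- A run of MR-LPF over `T` steps (time `t = 0, …, T - 1`, rounds `r = 1, …, R`) on a probability
space: `z t` is the pair of actions selected at time `t`, `y t` the feedback (`true` means that the
first action is preferred), `M r` the set of actions active in round `r`, and `hhat r` the
prediction computed at the end of round `r`, in the RKHS `D` of the dueling kernel.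
`ℱ t` is the information available before the feedback of time `t` is drawn. -/
structure IsMRLPFRun {X : Type*} [Fintype X] [DecidableEq X]
    {D : Type*} [NormedAddCommGroup D] [InnerProductSpace ℝ D] [RKHS ℝ D (X × X) ℝ]
    {Ω : Type*} {mΩ : MeasurableSpace Ω} (P : Measure Ω) (ℱ : Filtration ℕ mΩ)
    (k : X → X → ℝ) (f : X → ℝ) (B lam δ : ℝ) (T : ℕ)
    (z : ℕ → Ω → X × X) (y : ℕ → Ω → Bool) (M : ℕ → Ω → Finset X) (hhat : ℕ → Ω → D) :
    Prop where
  /-- All actions are active in the first round. -/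
  init : ∀ ω, M 1 ω = Finset.univ
  /-- Both selected actions are active. -/
  select_mem : ∀ r ∈ Finset.Icc 1 (numRounds T), ∀ n < roundLen T r, ∀ ω,
    (z (roundStart T r + n) ω).1 ∈ M r ω ∧ (z (roundStart T r + n) ω).2 ∈ M r ω
  /-- The selected pair has the largest uncertainty given the earlier points of the round. -/
  select_max : ∀ r ∈ Finset.Icc 1 (numRounds T), ∀ n < roundLen T r, ∀ ω,
    ∀ x ∈ M r ω, ∀ x' ∈ M r ω,
      sigma (duelingKernel k) (lam * kappaRound f r) (roundData T r n fun t => z t ω) (x, x') ≤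
      sigma (duelingKernel k) (lam * kappaRound f r) (roundData T r n fun t => z t ω)
        (z (roundStart T r + n) ω)
  /-- The prediction minimizes the loss on the data of the round. -/
  estimate : ∀ r ∈ Finset.Icc 1 (numRounds T), ∀ ω,
    IsMinOn (logisticLoss (D := D) lam (roundData T r (roundLen T r) fun t => z t ω)
      (roundData T r (roundLen T r) fun t => y t ω)) Set.univ (hhat r ω)
  /-- Actions that are unlikely to be optimal are eliminated. -/
  update : ∀ r ∈ Finset.Icc 1 (numRounds T), ∀ ω, ∀ x,
    x ∈ M (r + 1) ω ↔ x ∈ M r ω ∧ ∀ x' ∈ M r ω,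
      1 / 2 ≤ Real.sigmoid (hhat r ω (x, x')) + beta f B lam δ T r *
        sigma (duelingKernel k) (lam * kappaRound f r)
          (roundData T r (roundLen T r) fun t => z t ω) (x, x')
  /-- The points of a round, including the tie-breaking, do not use the feedback of that round. -/
  select_meas : ∀ r ∈ Finset.Icc 1 (numRounds T), ∀ n < roundLen T r, ∀ w,
    MeasurableSet[ℱ (roundStart T r)] {ω | z (roundStart T r + n) ω = w}
  /-- The feedback of time `t` is known afterwards. -/
  feedback_meas : ∀ t < T, MeasurableSet[ℱ (t + 1)] {ω | y t ω = true}
  /-- Given the past, the feedback is Bernoulli with the Bradley–Terry–Luce parameter. -/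
  feedback_law : ∀ t < T,
    P[Set.indicator {ω | y t ω = true} (fun _ => (1 : ℝ)) | ℱ t]
      =ᵐ[P] fun ω => prefProb f (z t ω).1 (z t ω).2

/-- Regret over `T` steps of a sequence `s` of pairs, with respect to the action `xstar`. -/
def regret {X : Type*} (f : X → ℝ) (xstar : X) (T : ℕ) (s : ℕ → X × X) : ℝ :=
  ∑ t ∈ Finset.range T,
    (prefProb f xstar (s t).1 + prefProb f xstar (s t).2 - 1) / 2

/-- The constant `C = 2 √(2 / log (1 + 4 (6 λ)⁻¹))`. -/
def constC (lam : ℝ) : ℝ := 2 * √(2 / Real.log (1 + 4 * (6 * lam)⁻¹))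

/-- The regret bound `2 C R β_(R)(δ) √(Γ_{4λ}(T)) (√T + 1)`. -/
def regretBound {X : Type*} [Fintype X] (k : X → X → ℝ) (f : X → ℝ) (B lam δ : ℝ) (T : ℕ) : ℝ :=
  2 * constC lam * (numRounds T : ℝ) * beta f B lam δ T (numRounds T) *
    √(infoGain (duelingKernel k) (4 * lam) T) * (√(T : ℝ) + 1)

end BOHF

end

/-! The horizon threshold may depend on the finite action set, the kernel and `B`, so constants
involving κ or the number of actions need not be sharp: they only have to be dominated eventually by
√Γ. If some pair has positive dueling kernel on the diagonal, repeating it makes Γ grow at least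
like log T (`le_infoGain`). Otherwise the utility is constant and the regret vanishes.

The confidence width must match β exactly, including `κ_r = 6` after the first round. Testing the
stationarity of the logistic estimate against its error `e` gives an energy inequality, which is
used twice in `abs_sigmoid_estimate_sub_le`. A crude pass bounds the energy polynomially in the
confidence logarithm (`energy_le_consistencyConst`). Maximal-uncertainty sampling makes σ² of order
1/N on active pairs (`sigma_sq_le_of_max`), so `e` is tiny at the sampled points and the curvature
there is nearly that of the truth; a second pass gives the sharp width (`sqrt_energy_le`).

The noise is controlled simultaneously in all directions of the finite-dimensional space of
functions on pairs, using a finite norming set (`measure_exists_noise_gt_le`). The size of that set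
is absorbed because the confidence logarithm tends to infinity with the number of rounds.

On the good event the optimum survives, and after round r every active action has gap O(β/√N_r)
(`IsMRLPFRun.mem_and_gap_le`). Such gaps are small enough to force a sigmoid derivative of at least
1/6 in later rounds. Since N_{r+1} is about √(N_r T), each round costs O(β√T)
(`IsMRLPFRun.regret_le`), and the number of rounds is O(log log T). -/

namespace BOHF

open scoped InnerProductSpace

/-! ### Uncertainty as a regularized approximation error -/

section Kernel

variable {S : Type*} {D : Type*} [NormedAddCommGroup D] [InnerProductSpace ℝ D] [CompleteSpace D]
  [RKHS ℝ D S ℝ]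

/-- The kernel function of the point `w`. -/
noncomputable def feature (D : Type*) {S : Type*} [NormedAddCommGroup D] [InnerProductSpace ℝ D]
    [CompleteSpace D] [RKHS ℝ D S ℝ] (w : S) : D := RKHS.kerFun D w 1

lemma inner_feature (u : D) (w : S) : ⟪u, feature D w⟫_ℝ = u w := by
  simp [feature]

lemma feature_apply {q : S → S → ℝ} (hq : HasKernel D q) (v w : S) : feature D v w = q w v := by
  rw [feature, RKHS.kerFun_apply, hq]

lemma inner_feature_feature {q : S → S → ℝ} (hq : HasKernel D q) (v w : S) :
    ⟪feature D v, feature D w⟫_ℝ = q v w := by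
  rw [real_inner_comm, inner_feature, feature_apply hq]

lemma HasKernel.symm {q : S → S → ℝ} (hq : HasKernel D q) (v w : S) : q v w = q w v := by
  rw [← inner_feature_feature hq, real_inner_comm, inner_feature_feature hq]

lemma HasKernel.diag {q : S → S → ℝ} (hq : HasKernel D q) (w : S) :
    q w w = ‖feature D w‖ ^ 2 := by
  rw [← inner_feature_feature hq, real_inner_self_eq_norm_sq]

lemma abs_apply_le (u : D) (w : S) : |u w| ≤ ‖u‖ * ‖feature D w‖ := by
  rw [← inner_feature]; exact abs_real_inner_le_norm _ _

/-- The regularized error of approximating the feature of `w` by a combination of the features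
of the points `zs`. -/
noncomputable def approxErr (D : Type*) {S : Type*} [NormedAddCommGroup D] [InnerProductSpace ℝ D]
    [CompleteSpace D] [RKHS ℝ D S ℝ] (ρ : ℝ) {n : ℕ} (zs : Fin n → S) (w : S) (c : Fin n → ℝ) :
    ℝ :=
  ‖feature D w - ∑ i, c i • feature D (zs i)‖ ^ 2 + ρ * ∑ i, c i ^ 2

lemma approxErr_nonneg {ρ : ℝ} (hρ : 0 < ρ) {n : ℕ} (zs : Fin n → S) (w : S) (c : Fin n → ℝ) :
    0 ≤ approxErr D ρ zs w c := by
  unfold approxErr; positivity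

lemma norm_sum_feature_sq {q : S → S → ℝ} (hq : HasKernel D q) {n : ℕ} (zs : Fin n → S)
    (c : Fin n → ℝ) : ‖∑ i, c i • feature D (zs i)‖ ^ 2 = c ⬝ᵥ (gram q zs).mulVec c := by
  rw [← real_inner_self_eq_norm_sq, sum_inner]
  simp only [inner_sum, inner_smul_left, inner_smul_right, inner_feature_feature hq, dotProduct,
    Matrix.mulVec, gram, Matrix.of_apply, Finset.mul_sum]
  refine Finset.sum_congr rfl fun i _ => Finset.sum_congr rfl fun j _ => ?_
  simp; ring

lemma approxErr_eq {q : S → S → ℝ} (hq : HasKernel D q) (ρ : ℝ) {n : ℕ} (zs : Fin n → S) (w : S)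
    (c : Fin n → ℝ) :
    approxErr D ρ zs w c = q w w - 2 * (c ⬝ᵥ kvec q zs w) +
      c ⬝ᵥ (gram q zs + ρ • (1 : Matrix (Fin n) (Fin n) ℝ)).mulVec c := by
  rw [approxErr, norm_sub_sq_real, ← hq.diag, norm_sum_feature_sq hq, Matrix.add_mulVec,
    Matrix.smul_mulVec, Matrix.one_mulVec, dotProduct_add, dotProduct_smul]
  have h1 : ⟪feature D w, ∑ i, c i • feature D (zs i)⟫_ℝ = c ⬝ᵥ kvec q zs w := by
    simp [inner_sum, inner_smul_right, inner_feature_feature hq, dotProduct, kvec]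
  have h2 : c ⬝ᵥ c = ∑ i, c i ^ 2 := by simp [dotProduct, sq]
  rw [h1, h2, smul_eq_mul]; ring

lemma posDef_gram_add {q : S → S → ℝ} (hq : HasKernel D q) {ρ : ℝ} (hρ : 0 < ρ) {n : ℕ}
    (zs : Fin n → S) : (gram q zs + ρ • (1 : Matrix (Fin n) (Fin n) ℝ)).PosDef := by
  refine Matrix.PosDef.posSemidef_add ?_ (Matrix.PosDef.one.smul hρ)
  refine Matrix.PosSemidef.of_dotProduct_mulVec_nonneg ?_ fun c => ?_
  · ext i j; simp [gram, hq.symm (zs i) (zs j)]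
  · simpa using (norm_sum_feature_sq hq zs c) ▸ sq_nonneg _

/-- The optimal coefficients in `approxErr`. -/
lemma exists_sigma_sq {q : S → S → ℝ} (hq : HasKernel D q) {ρ : ℝ} (hρ : 0 < ρ) {n : ℕ}
    (zs : Fin n → S) (w : S) :
    (∃ c, sigma q ρ zs w ^ 2 = approxErr D ρ zs w c) ∧
      ∀ c, sigma q ρ zs w ^ 2 ≤ approxErr D ρ zs w c := by
  have hpd := posDef_gram_add hq hρ zs
  set A := gram q zs + ρ • (1 : Matrix (Fin n) (Fin n) ℝ) with hA
  set b := kvec q zs w with hb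
  have hdet : IsUnit A.det := (Matrix.isUnit_iff_isUnit_det _).1 hpd.isUnit
  have hAc : A.mulVec (A⁻¹.mulVec b) = b := by
    rw [Matrix.mulVec_mulVec, Matrix.mul_nonsing_inv _ hdet, Matrix.one_mulVec]
  have hsymm : A.transpose = A := by
    have h : A.IsSymm := by simpa using hpd.isHermitian
    exact h
  have hval : approxErr D ρ zs w (A⁻¹.mulVec b) = q w w - b ⬝ᵥ A⁻¹.mulVec b := by
    rw [approxErr_eq hq, ← hA, hAc, ← hb, dotProduct_comm b]; ring
  have hs : sigma q ρ zs w ^ 2 = approxErr D ρ zs w (A⁻¹.mulVec b) := by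
    rw [hval, sigma, Real.sq_sqrt]
    rw [← hval]; exact approxErr_nonneg hρ _ _ _
  refine ⟨⟨_, hs⟩, fun c => ?_⟩
  rw [hs]
  set c₀ := A⁻¹.mulVec b
  -- Completing the square: `c₀` solves the normal equations, so the excess error at `c` is this
  -- quadratic form.
  have h0 : 0 ≤ (c - c₀) ⬝ᵥ A.mulVec (c - c₀) := by
    simpa using hpd.posSemidef.dotProduct_mulVec_nonneg (c - c₀)
  have h1 : c₀ ⬝ᵥ A.mulVec c = c ⬝ᵥ b := by
    rw [Matrix.dotProduct_mulVec, ← Matrix.mulVec_transpose, hsymm, hAc, dotProduct_comm]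
  rw [approxErr_eq hq, approxErr_eq hq, ← hA, hAc, ← hb]
  rw [Matrix.mulVec_sub, hAc, sub_dotProduct, dotProduct_sub, dotProduct_sub, h1] at h0
  linarith

lemma sigma_nonneg (q : S → S → ℝ) (ρ : ℝ) {n : ℕ} (zs : Fin n → S) (w : S) :
    0 ≤ sigma q ρ zs w := Real.sqrt_nonneg _

/-- Splitting the feature of `w` into its best approximation and the residual bounds `u w` by two
Cauchy–Schwarz estimates. This turns energy bounds into pointwise ones. -/
lemma apply_sq_le_sigma_sq {q : S → S → ℝ} (hq : HasKernel D q) {ρ : ℝ} (hρ : 0 < ρ) {n : ℕ}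
    (zs : Fin n → S) (w : S) (u : D) :
    u w ^ 2 ≤ sigma q ρ zs w ^ 2 * (‖u‖ ^ 2 + (∑ i, u (zs i) ^ 2) / ρ) := by
  obtain ⟨c, hc⟩ := (exists_sigma_sq (D := D) hq hρ zs w).1
  rw [hc, approxErr]
  set v := feature D w - ∑ i, c i • feature D (zs i) with hv
  have h1 : u w = ⟪u, v⟫_ℝ + ∑ i, c i * u (zs i) := by
    simp [hv, inner_sub_right, inner_sum, inner_smul_right, inner_feature]
  have h2 : |⟪u, v⟫_ℝ| ≤ ‖u‖ * ‖v‖ := abs_real_inner_le_norm _ _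
  have h3 : (∑ i, c i * u (zs i)) ^ 2 ≤ (∑ i, c i ^ 2) * ∑ i, u (zs i) ^ 2 :=
    Finset.sum_mul_sq_le_sq_mul_sq _ _ _
  set a := ⟪u, v⟫_ℝ
  set b := ∑ i, c i * u (zs i)
  set C := ∑ i, c i ^ 2
  set U := ∑ i, u (zs i) ^ 2
  have hC : 0 ≤ C := Finset.sum_nonneg fun i _ => sq_nonneg _
  have hU : 0 ≤ U := Finset.sum_nonneg fun i _ => sq_nonneg _
  -- Cauchy–Schwarz in the plane merges the two estimates; the factors ρ and 1/ρ cancel in the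
  -- second product.
  have hcs := Finset.sum_mul_sq_le_sq_mul_sq Finset.univ ![‖v‖, √(ρ * C)] ![‖u‖, √(U / ρ)]
  simp only [Fin.sum_univ_two, Matrix.cons_val_zero, Matrix.cons_val_one] at hcs
  rw [Real.sq_sqrt (by positivity), Real.sq_sqrt (by positivity)] at hcs
  refine le_trans ?_ hcs
  rw [h1, ← Real.sqrt_mul (by positivity), show ρ * C * (U / ρ) = C * U by field_simp]
  rw [sq_le_sq, abs_of_nonneg (a := _ + √(C * U)) (by positivity)]
  refine (abs_add_le _ _).trans (add_le_add (by linarith) ?_)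
  exact Real.abs_le_sqrt h3

/-- Coefficients for fewer points, padded with zeros, remain admissible for more points. -/
lemma sigma_le_of_embedding {q : S → S → ℝ} (hq : HasKernel D q) {ρ : ℝ} (hρ : 0 < ρ) {n N : ℕ}
    (s : ℕ → S) (hn : n ≤ N) (w : S) :
    sigma q ρ (fun i : Fin N => s i) w ≤ sigma q ρ (fun i : Fin n => s i) w := by
  refine (sq_le_sq₀ (sigma_nonneg ..) (sigma_nonneg ..)).1 ?_
  obtain ⟨c, hc⟩ := (exists_sigma_sq (D := D) hq hρ (fun i : Fin n => s i) w).1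
  rw [hc]
  obtain ⟨j, rfl⟩ := Nat.exists_eq_add_of_le hn
  refine ((exists_sigma_sq (D := D) hq hρ _ w).2 (Fin.append c 0)).trans (le_of_eq ?_)
  simp [approxErr, Fin.sum_univ_add]

/-- Equal weights on the occurrences of `w` reproduce its feature exactly, so only the penalty
remains. -/
lemma sigma_sq_le_of_card {q : S → S → ℝ} (hq : HasKernel D q) {ρ : ℝ} (hρ : 0 < ρ) {n : ℕ}
    (zs : Fin n → S) (w : S) (A : Finset (Fin n)) (hA : ∀ i ∈ A, zs i = w) (hA0 : A.Nonempty) :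
    sigma q ρ zs w ^ 2 ≤ ρ / A.card := by
  have hc : (0 : ℝ) < A.card := by exact_mod_cast hA0.card_pos
  refine ((exists_sigma_sq (D := D) hq hρ _ w).2
    (fun i => if i ∈ A then (A.card : ℝ)⁻¹ else 0)).trans (le_of_eq ?_)
  have h1 : ∑ i, (if i ∈ A then (A.card : ℝ)⁻¹ else 0) • feature D (zs i) = feature D w := by
    simp only [ite_smul, zero_smul, Finset.sum_ite_mem, Finset.univ_inter]
    rw [Finset.sum_congr rfl fun i hi => by rw [hA i hi], Finset.sum_const,
      ← Nat.cast_smul_eq_nsmul ℝ, smul_smul, mul_inv_cancel₀ hc.ne', one_smul]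
  rw [approxErr, h1]
  simp only [ite_pow, sub_self, norm_zero, Finset.sum_ite_mem, Finset.univ_inter,
    Finset.sum_const, nsmul_eq_mul, zero_pow two_ne_zero]
  field_simp; ring

/-- Sampling points of largest uncertainty makes the uncertainty small. -/
lemma sigma_sq_le_of_max [Fintype S] {q : S → S → ℝ} (hq : HasKernel D q) {ρ : ℝ}
    (hρ : 0 < ρ) {N : ℕ} (s : ℕ → S) (w : S) (hN : 2 * Fintype.card S ≤ N)
    (hmax : ∀ n < N, sigma q ρ (fun i : Fin n => s i) w ≤ sigma q ρ (fun i : Fin n => s i) (s n)) :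
    sigma q ρ (fun i : Fin N => s i) w ^ 2 ≤ 2 * ρ * Fintype.card S / N := by
  classical
  have hS : 0 < Fintype.card S := Fintype.card_pos_iff.2 ⟨w⟩
  have hm : (0 : ℝ) < Fintype.card S := by exact_mod_cast hS
  have hNpos : (0 : ℝ) < N := by exact_mod_cast (by omega : 0 < N)
  -- Pigeonhole: some `v` is sampled at least N/|S| ≥ 2 times. At its last selection it had occurred
  -- `F.card - 1` times already, and its uncertainty then dominated that of `w`.
  obtain ⟨v, -, hv⟩ := Finset.exists_le_card_fiber_of_nsmul_le_card_of_maps_to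
    (s := Finset.range N) (t := Finset.univ) (f := s) (b := (N : ℝ) / Fintype.card S)
    (fun _ _ => Finset.mem_univ _) ⟨w, Finset.mem_univ _⟩ (by
      rw [nsmul_eq_mul, Finset.card_univ, Finset.card_range, mul_div_cancel₀ _ hm.ne'])
  set F := (Finset.range N).filter fun i => s i = v with hF
  have h2 : (2 : ℝ) ≤ N / Fintype.card S := by
    rw [le_div_iff₀ hm]; exact_mod_cast hN
  have hF2 : 2 ≤ F.card := by exact_mod_cast h2.trans hv
  have hne : F.Nonempty := Finset.card_pos.1 (by omega)
  set n := F.max' hne with hn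
  have hnF : n ∈ F := Finset.max'_mem _ _
  have hnN : n < N := by simpa using (Finset.mem_filter.1 hnF).1
  have hnv : s n = v := (Finset.mem_filter.1 hnF).2
  let A : Finset (Fin n) := Finset.univ.filter fun i => s i = v
  have hmap : A.card = (F.erase n).card := by
    refine Finset.card_bij (fun i _ => (i : ℕ)) ?_ (fun i _ j _ h => Fin.ext h) ?_
    · intro i hi
      have hi' : s i = v := by simpa [A] using hi
      simp only [Finset.mem_erase, hF, Finset.mem_filter, Finset.mem_range]
      exact ⟨i.2.ne, i.2.trans hnN, hi'⟩
    · intro i hi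
      have hi' := Finset.mem_of_mem_erase hi
      have : i < n := lt_of_le_of_ne (Finset.le_max' _ _ hi') (Finset.ne_of_mem_erase hi)
      exact ⟨⟨i, this⟩, by simpa [A] using (Finset.mem_filter.1 hi').2, rfl⟩
  rw [Finset.card_erase_of_mem hnF] at hmap
  have hA0 : A.Nonempty := Finset.card_pos.1 (by omega)
  have h3 := sigma_sq_le_of_card (D := D) hq hρ (fun i : Fin n => s i) v A
    (fun i hi => by simpa [A] using hi) hA0
  have h4 : sigma q ρ (fun i : Fin N => s i) w ≤ sigma q ρ (fun i : Fin n => s i) v := by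
    refine (sigma_le_of_embedding (D := D) hq hρ s hnN.le w).trans ?_
    simpa [hnv] using hmax n hnN
  refine (pow_le_pow_left₀ (sigma_nonneg ..) h4 2).trans (h3.trans ?_)
  have hAc : (A.card : ℝ) = F.card - 1 := by
    rw [hmap]; push_cast [Nat.cast_sub (by omega : 1 ≤ F.card)]; ring
  rw [div_le_div_iff₀ (by exact_mod_cast hA0.card_pos) hNpos, hAc]
  have h5 : (N : ℝ) ≤ F.card * Fintype.card S := by rwa [div_le_iff₀ hm] at hv
  have h6 : (2 : ℝ) ≤ F.card := by exact_mod_cast hF2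
  -- The factor 2 pays for dropping the last occurrence: `F.card - 1` is at least half of `F.card`.
  nlinarith [mul_nonneg (sub_nonneg.2 h6) (mul_pos hρ hm).le, mul_le_mul_of_nonneg_left h5 hρ.le]

end Kernel

/-! ### The dueling kernel and a lower bound on information gain -/

section Dueling

variable {X : Type*} {H : Type*} [NormedAddCommGroup H] [InnerProductSpace ℝ H] [CompleteSpace H]
  [RKHS ℝ H X ℝ] {D : Type*} [NormedAddCommGroup D] [InnerProductSpace ℝ D] [CompleteSpace D]
  [RKHS ℝ D (X × X) ℝ]

lemma duelingKernel_eq_inner {k : X → X → ℝ} (hk : HasKernel H k) (v w : X × X) :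
    duelingKernel k v w =
      ⟪feature H v.1 - feature H v.2, feature H w.1 - feature H w.2⟫_ℝ := by
  simp only [inner_sub_left, inner_sub_right, inner_feature_feature hk, duelingKernel]
  ring

lemma duelingKernel_diag_le {k : X → X → ℝ} (hk : HasKernel H k) (hk1 : ∀ x x', k x x' ≤ 1)
    (w : X × X) : duelingKernel k w w ≤ 4 := by
  have h : ∀ x, ‖feature H x‖ ≤ 1 := fun x => by
    have := hk1 x x
    rw [hk.diag] at this
    exact (sq_le_one_iff₀ (norm_nonneg _)).1 this
  rw [duelingKernel_eq_inner hk, real_inner_self_eq_norm_sq]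
  have := (norm_sub_le (feature H w.1) (feature H w.2)).trans (add_le_add (h _) (h _))
  nlinarith [norm_nonneg (feature H w.1 - feature H w.2)]

/-- The difference of values of a function in the RKHS of `k` lies in the RKHS of the dueling
kernel, with no larger norm. -/
lemma exists_dueling_function [Fintype X] {k : X → X → ℝ} (hk : HasKernel H k)
    (hD : HasKernel D (duelingKernel k)) (f : H) :
    ∃ h : D, ‖h‖ ≤ ‖f‖ ∧ ∀ w : X × X, h w = f w.1 - f w.2 := by
  let φ : X × X → H := fun w => feature H w.1 - feature H w.2
  let W : Submodule ℝ H := Submodule.span ℝ (Set.range φ)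
  have : FiniteDimensional ℝ W := FiniteDimensional.span_of_finite ℝ (Set.finite_range φ)
  -- Projecting `f` onto the span of feature differences keeps all value differences and does not
  -- increase the norm. The same coefficients are then used in `D`, whose features have the same
  -- Gram matrix.
  obtain ⟨c, hc⟩ := (Submodule.mem_span_range_iff_exists_fun ℝ).1 (W.orthogonalProjectionOnto f).2
  have hφ : ∀ w, ⟪f, φ w⟫_ℝ = f w.1 - f w.2 := fun w => by
    simp [φ, inner_sub_right, inner_feature]
  have hker : ∀ v w, ⟪φ v, φ w⟫_ℝ = ⟪feature D v, feature D w⟫_ℝ := fun v w => by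
    rw [inner_feature_feature hD, duelingKernel_eq_inner hk]
  refine ⟨∑ w, c w • feature D w, ?_, fun w => ?_⟩
  · have h1 : ‖∑ w, c w • feature D w‖ ^ 2 = ‖(W.orthogonalProjectionOnto f : H)‖ ^ 2 := by
      rw [← hc, ← real_inner_self_eq_norm_sq, ← real_inner_self_eq_norm_sq]
      simp only [inner_sum, sum_inner, inner_smul_left, inner_smul_right, hker]
    have h2 := (pow_left_inj₀ (norm_nonneg _) (norm_nonneg _) two_ne_zero).1 h1
    rw [h2]
    exact W.norm_orthogonalProjectionOnto_apply_le f
  · rw [← inner_feature, ← hφ, sum_inner]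
    have h3 : ⟪f, φ w⟫_ℝ = ⟪(W.orthogonalProjectionOnto f : H), φ w⟫_ℝ := by
      have := W.inner_orthogonalProjectionOnto_eq_of_mem_right
        (⟨φ w, Submodule.subset_span ⟨w, rfl⟩⟩ : W) f
      rw [Submodule.coe_inner] at this
      exact this.symm
    rw [h3, ← hc, sum_inner]
    simp only [inner_smul_left, hker]

lemma apply_sub_eq_zero_of_diag {k : X → X → ℝ} (hk : HasKernel H k) (f : H) (x x' : X)
    (h : duelingKernel k (x, x') (x, x') = 0) : f x = f x' := by
  rw [duelingKernel_eq_inner hk, real_inner_self_eq_norm_sq] at h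
  have h0 : feature H x - feature H x' = 0 := by simpa using h
  have : ⟪f, feature H x - feature H x'⟫_ℝ = 0 := by rw [h0, inner_zero_right]
  rw [inner_sub_right, inner_feature, inner_feature] at this
  linarith

/-- Repeating one point gives a rank-one Gram matrix, whose determinant is explicit. -/
lemma le_infoGain {S : Type*} [Finite S] (q : S → S → ℝ) (ρ : ℝ) (T : ℕ) (w : S) :
    1 / 2 * Real.log (1 + T * (ρ⁻¹ * q w w)) ≤ infoGain q ρ T := by
  refine le_trans (le_of_eq ?_) (le_ciSup (Set.finite_range _).bddAbove (fun _ : Fin T => w))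
  congr 2
  have : (ρ⁻¹ • gram q fun _ : Fin T => w) =
      Matrix.replicateCol Unit (fun _ : Fin T => ρ⁻¹ * q w w) *
        Matrix.replicateRow Unit (fun _ : Fin T => (1 : ℝ)) := by
    ext i j; simp [gram, Matrix.mul_apply]
  rw [this, Matrix.det_one_add_mul_comm]
  simp [Matrix.mul_apply, Matrix.det_unique]

end Dueling

/-! ### Curvature of the sigmoid and Hoeffding's lemma -/

section Sigmoid

open Real

lemma deriv_sigmoid_eq (x : ℝ) : deriv sigmoid x = 1 / 4 - (sigmoid x - 1 / 2) ^ 2 := by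
  rw [deriv_sigmoid]; ring

lemma deriv_sigmoid_pos (x : ℝ) : 0 < deriv sigmoid x := by
  rw [deriv_sigmoid]
  exact mul_pos (sigmoid_pos x) (sub_pos.2 (sigmoid_lt_one x))

lemma deriv_sigmoid_le (x : ℝ) : deriv sigmoid x ≤ 1 / 4 := by
  rw [deriv_sigmoid_eq]; nlinarith [sq_nonneg (sigmoid x - 1 / 2)]

lemma deriv_sigmoid_zero : deriv sigmoid 0 = 1 / 4 := by
  rw [deriv_sigmoid_eq, sigmoid_zero]; norm_num

lemma sigmoid_sub_eq (a b : ℝ) :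
    ∃ ξ, |ξ - a| ≤ |b - a| ∧ sigmoid b - sigmoid a = deriv sigmoid ξ * (b - a) := by
  have hd : ∀ x y, ∀ ξ ∈ Set.Icc x y, DifferentiableAt ℝ sigmoid ξ :=
    fun x y ξ _ => (hasDerivAt_sigmoid ξ).differentiableAt
  rcases lt_trichotomy a b with h | rfl | h
  · obtain ⟨ξ, hξ, he⟩ := exists_deriv_eq_slope sigmoid h continuous_sigmoid.continuousOn
      fun x _ => (hasDerivAt_sigmoid x).differentiableAt.differentiableWithinAt
    refine ⟨ξ, ?_, ?_⟩
    · rw [abs_of_pos (sub_pos.2 hξ.1), abs_of_pos (sub_pos.2 h)]; linarith [hξ.2]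
    · rw [he, div_mul_cancel₀ _ (sub_pos.2 h).ne']
  · exact ⟨a, by simp, by simp⟩
  · obtain ⟨ξ, hξ, he⟩ := exists_deriv_eq_slope sigmoid h continuous_sigmoid.continuousOn
      fun x _ => (hasDerivAt_sigmoid x).differentiableAt.differentiableWithinAt
    refine ⟨ξ, ?_, ?_⟩
    · rw [abs_of_neg (sub_neg.2 hξ.2), abs_of_neg (sub_neg.2 h)]; linarith [hξ.1]
    · rw [he, div_mul_eq_mul_div, eq_div_iff (sub_pos.2 h).ne']; ring

lemma abs_sigmoid_sub_le (a b : ℝ) : |sigmoid b - sigmoid a| ≤ 1 / 4 * |b - a| := by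
  obtain ⟨ξ, -, h⟩ := sigmoid_sub_eq a b
  rw [h, abs_mul, abs_of_pos (deriv_sigmoid_pos ξ)]
  exact mul_le_mul_of_nonneg_right (deriv_sigmoid_le ξ) (abs_nonneg _)

/-- Since μ' = μ(1 - μ), the difference of derivatives factors through μ(b) - μ(a), and the other
factor has absolute value at most 1. -/
lemma deriv_sigmoid_sub_le (a b : ℝ) : deriv sigmoid a - |b - a| / 4 ≤ deriv sigmoid b := by
  have h := abs_sigmoid_sub_le a b
  have h1 : deriv sigmoid a - deriv sigmoid b =
      (sigmoid b - sigmoid a) * (sigmoid a + sigmoid b - 1) := by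
    rw [deriv_sigmoid_eq, deriv_sigmoid_eq]; ring
  have h2 : |sigmoid a + sigmoid b - 1| ≤ 1 := by
    rw [abs_le]; constructor <;>
      linarith [sigmoid_pos a, sigmoid_pos b, sigmoid_lt_one a, sigmoid_lt_one b]
  have h3 := le_abs_self (deriv sigmoid a - deriv sigmoid b)
  rw [h1, abs_mul] at h3
  have h4 := mul_le_mul_of_nonneg_left h2 (abs_nonneg (sigmoid b - sigmoid a))
  rw [← h1] at h3
  linarith

lemma deriv_sigmoid_le_of_abs_le {x M : ℝ} (h : |x| ≤ M) : deriv sigmoid M ≤ deriv sigmoid x := by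
  rw [deriv_sigmoid_eq, deriv_sigmoid_eq]
  have h1 := sigmoid_le (abs_le.1 h).1
  have h2 := sigmoid_le (abs_le.1 h).2
  rw [sigmoid_neg] at h1
  have := sq_le_sq' (a := sigmoid x - 1 / 2) (b := sigmoid M - 1 / 2) (by linarith) (by linarith)
  linarith

/-- No bound on `e` is available in the crude pass. Up to size 1 the mean value theorem gives
quadratic growth; beyond it monotonicity keeps at least the unit increment, hence linear growth. The
quotient covers both regimes. -/
lemma sigmoid_sub_mul_ge {a e M : ℝ} (ha : |a| ≤ M) :
    deriv sigmoid (M + 1) * (e ^ 2 / (1 + |e|)) ≤ (sigmoid (a + e) - sigmoid a) * e := by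
  have hc := deriv_sigmoid_pos (M + 1)
  have hpos : 0 < 1 + |e| := by positivity
  have key : ∀ d, |d| ≤ 1 → ∃ α, deriv sigmoid (M + 1) ≤ α ∧
      sigmoid (a + d) - sigmoid a = α * d := by
    intro d hd
    obtain ⟨ξ, h1, h2⟩ := sigmoid_sub_eq a (a + d)
    rw [add_sub_cancel_left] at h1 h2
    refine ⟨_, deriv_sigmoid_le_of_abs_le ?_, h2⟩
    have := abs_add_le (ξ - a) a
    rw [sub_add_cancel] at this
    linarith
  have hfrac : e ^ 2 / (1 + |e|) ≤ |e| := by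
    rw [div_le_iff₀ hpos, ← sq_abs]; nlinarith [abs_nonneg e]
  by_cases he : |e| ≤ 1
  · obtain ⟨α, h1, h2⟩ := key e he
    rw [h2]
    have : e ^ 2 / (1 + |e|) ≤ e ^ 2 := div_le_self (sq_nonneg e) (by linarith [abs_nonneg e])
    nlinarith [sq_nonneg e]
  · refine (mul_le_mul_of_nonneg_left hfrac hc.le).trans ?_
    rcases le_total 0 e with h0 | h0
    · rw [abs_of_nonneg h0] at he ⊢
      obtain ⟨α, h1, h2⟩ := key 1 (by simp)
      have := sigmoid_le (show a + 1 ≤ a + e by linarith)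
      exact mul_le_mul_of_nonneg_right (by linarith) h0
    · rw [abs_of_nonpos h0] at he ⊢
      obtain ⟨α, h1, h2⟩ := key (-1) (by simp)
      have := sigmoid_le (show a + e ≤ a + -1 by linarith)
      nlinarith

/-- Sharp version for the second pass: for small `e` nearly the full curvature at `a` is retained.
-/
lemma sigmoid_sub_mul_ge_deriv (a e : ℝ) :
    (deriv sigmoid a - |e| / 4) * e ^ 2 ≤ (sigmoid (a + e) - sigmoid a) * e := by
  obtain ⟨ξ, h1, h2⟩ := sigmoid_sub_eq a (a + e)
  rw [add_sub_cancel_left] at h1 h2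
  rw [h2, mul_assoc, ← sq]
  have := deriv_sigmoid_sub_le a ξ
  exact mul_le_mul_of_nonneg_right (by linarith) (sq_nonneg e)

/-- The exponential moment of a centered Bernoulli variable. -/
lemma bernoulli_mgf_le {p : ℝ} (hp : p ∈ Set.Icc (0 : ℝ) 1) (c : ℝ) :
    p * exp (c * (1 - p)) + (1 - p) * exp (-(c * p)) ≤ exp (c ^ 2 / 8) := by
  classical
  let ν : Measure Bool := ENNReal.ofReal p • Measure.dirac true +
    ENNReal.ofReal (1 - p) • Measure.dirac false
  have hν : IsProbabilityMeasure ν := ⟨by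
    simp [ν, ← ENNReal.ofReal_add hp.1 (sub_nonneg.2 hp.2)]⟩
  have hint : ∀ g : Bool → ℝ, ∫ b, g b ∂ν = p * g true + (1 - p) * g false := fun g => by
    rw [integral_add_measure, integral_smul_measure, integral_smul_measure, integral_dirac,
      integral_dirac, ENNReal.toReal_ofReal hp.1, ENNReal.toReal_ofReal (sub_nonneg.2 hp.2)]
    · simp
    · exact Integrable.of_finite.smul_measure ENNReal.ofReal_ne_top
    · exact Integrable.of_finite.smul_measure ENNReal.ofReal_ne_top
  have h := ProbabilityTheory.hasSubgaussianMGF_of_mem_Icc_of_integral_eq_zero (μ := ν)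
    (X := fun b => if b then 1 - p else -p) (a := -p) (b := 1 - p)
    (measurable_of_countable _).aemeasurable
    (Filter.Eventually.of_forall fun b => by
      cases b <;> simp) (by rw [hint]; simp; ring)
  have h2 := h.mgf_le c
  rw [ProbabilityTheory.mgf, hint] at h2
  simp only [if_true, Bool.false_eq_true, if_false] at h2
  have : ((‖1 - p - -p‖₊ / 2) ^ 2 : NNReal) = (1 / 4 : ℝ) := by
    norm_num
  rw [this] at h2
  rw [show c ^ 2 / 8 = 1 / 4 * c ^ 2 / 2 by ring, ← mul_neg]
  exact h2

end Sigmoid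

/-! ### Stationarity of the logistic estimate -/

section Loss

variable {S : Type*} {D : Type*} [NormedAddCommGroup D] [InnerProductSpace ℝ D] [RKHS ℝ D S ℝ]

lemma hasDerivAt_logistic_term (y a b t : ℝ) :
    HasDerivAt (fun t => -y * Real.log (Real.sigmoid (a + t * b))
      - (1 - y) * Real.log (1 - Real.sigmoid (a + t * b)))
      ((Real.sigmoid (a + t * b) - y) * b) t := by
  have h0 : HasDerivAt (fun t : ℝ => a + t * b) b t := by
    simpa using ((hasDerivAt_id t).mul_const b).const_add a
  have h1 := (Real.hasDerivAt_sigmoid (a + t * b)).comp t h0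
  have hp := Real.sigmoid_pos (a + t * b)
  have hq : 0 < 1 - Real.sigmoid (a + t * b) := sub_pos.2 (Real.sigmoid_lt_one _)
  have h2 := (h1.log hp.ne').const_mul (-y)
  have h3 := ((h1.const_sub 1).log hq.ne').const_mul (1 - y)
  refine (h2.sub h3).congr_deriv ?_
  simp only [Function.comp]
  field_simp
  ring

/-- The stationarity condition of a minimizer of the regularized logistic loss. -/
lemma inner_add_sum_eq_zero_of_isMinOn {lam : ℝ} {n : ℕ} {zs : Fin n → S} {ys : Fin n → Bool}
    {g : D} (hg : IsMinOn (logisticLoss (D := D) lam zs ys) Set.univ g) (u : D) :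
    lam * ⟪g, u⟫_ℝ +
      ∑ i, (Real.sigmoid (g (zs i)) - (if ys i then 1 else 0)) * u (zs i) = 0 := by
  have h1 : HasDerivAt (fun t : ℝ => logisticLoss lam zs ys (g + t • u))
      ((∑ i, (Real.sigmoid (g (zs i)) - (if ys i then 1 else 0)) * u (zs i)) +
        lam * ⟪g, u⟫_ℝ) 0 := by
    unfold logisticLoss
    refine HasDerivAt.add ?_ ?_
    · refine HasDerivAt.fun_sum fun i _ => ?_
      have := hasDerivAt_logistic_term (if ys i then 1 else 0) (g (zs i)) (u (zs i)) 0
      simpa using this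
    · have h2 : HasDerivAt (fun t : ℝ => lam / 2 * (‖g‖ ^ 2 + 2 * (t * ⟪g, u⟫_ℝ) +
          t ^ 2 * ‖u‖ ^ 2)) (lam * ⟪g, u⟫_ℝ) 0 := by
        have h3 := ((((hasDerivAt_id (0 : ℝ)).mul_const ⟪g, u⟫_ℝ).const_mul 2).const_add
          (‖g‖ ^ 2)).add (((hasDerivAt_id (0 : ℝ)).pow 2).mul_const (‖u‖ ^ 2))
        refine (h3.const_mul (lam / 2)).congr_deriv ?_
        simp; ring
      refine h2.congr_of_eventuallyEq (Filter.Eventually.of_forall fun t => ?_)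
      simp only
      rw [norm_add_sq_real, inner_smul_right, norm_smul, mul_pow, Real.norm_eq_abs, sq_abs]
  have hmin : IsLocalMin (fun t : ℝ => logisticLoss lam zs ys (g + t • u)) 0 :=
    Filter.Eventually.of_forall fun t => by
      simpa using hg (Set.mem_univ (g + t • u))
  linarith [hmin.hasDerivAt_eq_zero h1]

end Loss

/-! ### From the energy inequality to the confidence width -/

section Confidence

/-- The constant in the polynomial consistency bound for the logistic estimate. -/
noncomputable def consistencyConst (B lam c : ℝ) : ℝ :=
  (1 + B + 2 / (c * lam)) ^ 2 + (2 * (1 + 2 * (1 + B + 2 / (c * lam))) *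
    (lam * B * (1 + B + 2 / (c * lam)) + (1 + 2 * (1 + B + 2 / (c * lam))) / (2 * c)) / c) /
      (4 * lam)

lemma consistencyConst_nonneg {B lam c : ℝ} (hB : 0 < B) (hlam : 0 < lam) (hc : 0 < c) :
    0 ≤ consistencyConst B lam c := by
  unfold consistencyConst; positivity

/-- The quadratic term in `E` beats the linear terms, so `E` is O(s). The curvature degrades only
like 1/(1 + 2E), and this costs one more power of `s` in the bound on `Z`, hence the cube. -/
lemma energy_le_consistencyConst {B lam c s E Z : ℝ} (hB : 0 < B) (hlam : 0 < lam) (hc : 0 < c)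
    (hs : 1 ≤ s) (hE : 0 ≤ E) (hZ : 0 ≤ Z)
    (h : lam * (E ^ 2 - B * E) + c / (1 + 2 * E) * Z ≤ √(s * Z)) :
    E ^ 2 + Z / (4 * lam) ≤ consistencyConst B lam c * s ^ 3 := by
  unfold consistencyConst
  set a := 1 + B + 2 / (c * lam) with ha
  have ha0 : 0 < a := by positivity
  have hD : 0 < 1 + 2 * E := by positivity
  -- `x` is half of the curvature term; `y` is chosen so that √(sZ) = 2√(xy) ≤ x + y, which leaves
  -- the other half.
  set x := c / (1 + 2 * E) * Z / 2 with hx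
  set y := s * (1 + 2 * E) / (2 * c) with hy
  have hx0 : 0 ≤ x := by positivity
  have hy0 : 0 ≤ y := by positivity
  have hxy : s * Z = 4 * x * y := by rw [hx, hy]; field_simp; ring
  have hsq : √(s * Z) ≤ x + y := by
    rw [Real.sqrt_le_iff]
    exact ⟨by positivity, by rw [hxy]; nlinarith [sq_nonneg (x - y)]⟩
  have h1 : lam * (E ^ 2 - B * E) + x ≤ y := by
    have : c / (1 + 2 * E) * Z = 2 * x := by rw [hx]; ring
    linarith
  have hyt : y = s / c / 2 + s / c * E := by rw [hy]; field_simp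
  have hEa : E ≤ a * s := by
    by_contra hcon
    push Not at hcon
    set t := s / c with ht
    have ht0 : 0 < t := by positivity
    have has : a * s = s + B * s + 2 * (t / lam) := by rw [ha, ht]; field_simp
    have hu : lam * (t / lam) = t := by field_simp
    set u := t / lam
    have hE1 : 1 + B + 2 * u < E := by nlinarith
    have hu0 : 0 < u := by positivity
    have hE2 : 1 < E := by linarith
    have h2 : lam * (1 + B + 2 * u) * E < lam * E * E := by
      have := mul_lt_mul_of_pos_left hE1 hlam
      exact mul_lt_mul_of_pos_right this (by linarith)
    nlinarith [mul_pos hlam (by linarith : 0 < E), mul_pos ht0 (sub_pos.2 hE2)]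
  have h2 : x ≤ y + lam * B * E := by nlinarith [mul_nonneg hlam.le (sq_nonneg E)]
  have hD' : 1 + 2 * E ≤ (1 + 2 * a) * s := by nlinarith
  have hZc : Z = 2 * (1 + 2 * E) * x / c := by rw [hx]; field_simp
  have hs2 : s ≤ s ^ 2 := by nlinarith
  have h3 : x ≤ (lam * B * a + (1 + 2 * a) / (2 * c)) * s ^ 2 := by
    have h4 : y ≤ (1 + 2 * a) / (2 * c) * s ^ 2 := by
      rw [hy, div_mul_eq_mul_div]
      exact div_le_div_of_nonneg_right (by nlinarith) (by positivity)
    have h5 : lam * B * E ≤ lam * B * a * s ^ 2 := by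
      have : E ≤ a * s ^ 2 := hEa.trans (by gcongr)
      calc lam * B * E ≤ lam * B * (a * s ^ 2) := by gcongr
        _ = _ := by ring
    linarith
  have h6 : Z ≤ 2 * (1 + 2 * a) * (lam * B * a + (1 + 2 * a) / (2 * c)) / c * s ^ 3 := by
    rw [hZc]
    calc 2 * (1 + 2 * E) * x / c
        ≤ 2 * ((1 + 2 * a) * s) * ((lam * B * a + (1 + 2 * a) / (2 * c)) * s ^ 2) / c := by
          gcongr
      _ = _ := by ring
  have h7 : E ^ 2 ≤ a ^ 2 * s ^ 3 := by
    calc E ^ 2 ≤ (a * s) ^ 2 := by gcongr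
      _ = a ^ 2 * s ^ 2 := by ring
      _ ≤ a ^ 2 * s ^ 3 := by gcongr; norm_num
  calc E ^ 2 + Z / (4 * lam) ≤ a ^ 2 * s ^ 3 +
        (2 * (1 + 2 * a) * (lam * B * a + (1 + 2 * a) / (2 * c)) / c * s ^ 3) / (4 * lam) := by
        gcongr
    _ = _ := by ring

/-- Dividing the energy inequality by λQ gives 19/20 Q ≤ B + 9/10 V. This is below 19/20 (B + V)
exactly when B ≤ V, which `hl` and `hκ` ensure. -/
lemma sqrt_energy_le {B lam κ l E Z : ℝ} (hB : 0 < B) (hlam : 0 < lam) (hκ : 4 ≤ κ)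
    (hl : B ^ 2 * lam ≤ 4 * l) (hE : 0 ≤ E) (hZ : 0 ≤ Z)
    (h : lam * (E ^ 2 - B * E) + 19 / 20 / κ * Z ≤ √(4 / 5 * l * Z)) :
    √(E ^ 2 + Z / (lam * κ)) ≤ B + √(κ / lam * l) := by
  have hκ0 : 0 < κ := by linarith
  have hl0 : 0 < l := by nlinarith [mul_pos (pow_pos hB 2) hlam]
  set Q := √(E ^ 2 + Z / (lam * κ)) with hQ
  set V := √(κ / lam * l) with hV
  have hQ0 : 0 ≤ Q := Real.sqrt_nonneg _
  have hQ2 : Q ^ 2 = E ^ 2 + Z / (lam * κ) := Real.sq_sqrt (by positivity)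
  have hV2 : V ^ 2 = κ / lam * l := Real.sq_sqrt (by positivity)
  have hV0 : 0 < V := Real.sqrt_pos.2 (by positivity)
  have hEQ : E ≤ Q := Real.le_sqrt_of_sq_le (by linarith [show 0 ≤ Z / (lam * κ) by positivity])
  have hZQ : Z ≤ lam * κ * Q ^ 2 := by
    rw [hQ2, mul_add, mul_div_cancel₀ _ (by positivity)]
    linarith [show 0 ≤ lam * κ * E ^ 2 by positivity]
  -- The slack 4/5 in the noise bound, with 4/5 < 81/100, makes the factor 9/10 available.
  have h1 : √(4 / 5 * l * Z) ≤ 9 / 10 * lam * V * Q := by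
    rw [Real.sqrt_le_iff]
    refine ⟨by positivity, ?_⟩
    have : (9 / 10 * lam * V * Q) ^ 2 = 81 / 100 * l * (lam * κ * Q ^ 2) := by
      rw [mul_pow, mul_pow, hV2]; field_simp; ring
    rw [this]
    have : 4 / 5 * l * Z ≤ 4 / 5 * l * (lam * κ * Q ^ 2) := by gcongr
    have h0 : 0 ≤ l * (lam * κ * Q ^ 2) := by positivity
    linarith
  have hBV : B ≤ V := by
    refine Real.le_sqrt_of_sq_le ?_
    rw [div_mul_eq_mul_div, le_div_iff₀ hlam]
    nlinarith
  have h2 : 19 / 20 * lam * Q ^ 2 ≤ lam * E ^ 2 + 19 / 20 / κ * Z := by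
    rw [hQ2]
    have : 19 / 20 * lam * (E ^ 2 + Z / (lam * κ)) =
      19 / 20 * (lam * E ^ 2) + 19 / 20 / κ * Z := by field_simp
    rw [this]
    linarith [show 0 ≤ lam * E ^ 2 by positivity]
  have h3 : 19 / 20 * lam * Q ^ 2 ≤ lam * (B + 9 / 10 * V) * Q := by
    have := mul_le_mul_of_nonneg_left hEQ (mul_pos hlam hB).le
    linarith
  by_contra hcon
  push Not at hcon
  have hQpos : 0 < Q := by linarith
  have h4 : 19 / 20 * Q ≤ B + 9 / 10 * V := by
    have h5 : (lam * Q) * (19 / 20 * Q) ≤ (lam * Q) * (B + 9 / 10 * V) := by linarith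
    exact le_of_mul_le_mul_left h5 (mul_pos hlam hQpos)
  linarith

variable {S : Type*} {D : Type*} [NormedAddCommGroup D] [InnerProductSpace ℝ D] [CompleteSpace D]
  [RKHS ℝ D S ℝ]

/-- The confidence interval of the regularized logistic estimate, when the noise is small on the
sampled points and the uncertainty at these points is small. -/
theorem abs_sigmoid_estimate_sub_le {q : S → S → ℝ} (hq : HasKernel D q)
    (hq4 : ∀ w, q w w ≤ 4) {B lam κ l : ℝ} (hB : 0 < B) (hlam : 0 < lam) (hκ : 4 ≤ κ)
    (hl1 : 1 ≤ l) (hl : B ^ 2 * lam ≤ 4 * l) {n : ℕ} {zs : Fin n → S} {ys : Fin n → Bool}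
    {g h : D} (hh : ‖h‖ ≤ B)
    (hg : IsMinOn (logisticLoss (D := D) lam zs ys) Set.univ g)
    (hderiv : ∀ i, 1 / κ ≤ deriv Real.sigmoid (h (zs i)))
    (hnoise : ∀ v : S → ℝ, ∑ i, ((if ys i then 1 else 0) - Real.sigmoid (h (zs i))) * v (zs i) ≤
      √(4 / 5 * l * ∑ i, v (zs i) ^ 2))
    (hσ : ∀ i, sigma q (lam * κ) zs (zs i) ^ 2 *
      (consistencyConst B lam (deriv Real.sigmoid (2 * B + 1)) * l ^ 3) ≤ (1 / (5 * κ)) ^ 2)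
    (w : S) :
    |Real.sigmoid (g w) - Real.sigmoid (h w)| ≤
      1 / 4 * (B + √(κ / lam * l)) * sigma q (lam * κ) zs w := by
  have hκ0 : 0 < κ := by linarith
  have hρ : 0 < lam * κ := by positivity
  set c := deriv Real.sigmoid (2 * B + 1) with hc
  have hc0 : 0 < c := deriv_sigmoid_pos _
  set e := g - h with he
  have hge : ∀ v, g v = h v + e v := fun v => by simp [he]
  set Z := ∑ i, e (zs i) ^ 2 with hZ
  have hZ0 : 0 ≤ Z := Finset.sum_nonneg fun i _ => sq_nonneg _
  have hfeat : ∀ v, ‖feature D v‖ ≤ 2 := fun v => by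
    have := hq4 v
    rw [hq.diag] at this
    nlinarith [norm_nonneg (feature D v)]
  have habs : ∀ (u : D) v, |u v| ≤ 2 * ‖u‖ := fun u v => by
    have := abs_apply_le u v
    nlinarith [hfeat v, norm_nonneg u]
  -- The stationarity condition is tested against the error `e` itself.
  have henergy : lam * (‖e‖ ^ 2 - B * ‖e‖) +
      ∑ i, (Real.sigmoid (h (zs i) + e (zs i)) - Real.sigmoid (h (zs i))) * e (zs i) ≤
      √(4 / 5 * l * Z) := by
    have h1 := inner_add_sum_eq_zero_of_isMinOn hg e
    have h2 := hnoise e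
    have h3 : ⟪g, e⟫_ℝ = ‖e‖ ^ 2 + ⟪h, e⟫_ℝ := by
      rw [show g = e + h by simp [he], inner_add_left, real_inner_self_eq_norm_sq]
    have h4 : -(B * ‖e‖) ≤ ⟪h, e⟫_ℝ := by
      have := (abs_le.1 (abs_real_inner_le_norm h e)).1
      nlinarith [norm_nonneg e]
    have h5 : ∑ i, (Real.sigmoid (g (zs i)) - (if ys i then 1 else 0)) * e (zs i) =
        ∑ i, (Real.sigmoid (h (zs i) + e (zs i)) - Real.sigmoid (h (zs i))) * e (zs i) -
        ∑ i, ((if ys i then 1 else 0) - Real.sigmoid (h (zs i))) * e (zs i) := by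
      rw [← Finset.sum_sub_distrib]
      refine Finset.sum_congr rfl fun i _ => ?_
      rw [hge]; ring
    rw [h3, h5] at h1
    nlinarith
  -- Crude pass: only |h| ≤ 2B is used for the curvature.
  have hcons : ‖e‖ ^ 2 + Z / (4 * lam) ≤ consistencyConst B lam c * l ^ 3 := by
    refine energy_le_consistencyConst hB hlam hc0 hl1 (norm_nonneg _) hZ0 ?_
    have h1 : √(4 / 5 * l * Z) ≤ √(l * Z) :=
      Real.sqrt_le_sqrt (by nlinarith [mul_nonneg (by linarith : 0 ≤ l) hZ0])
    refine le_trans ?_ (henergy.trans h1)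
    rw [hZ, Finset.mul_sum]
    refine add_le_add le_rfl (Finset.sum_le_sum fun i _ => ?_)
    have h2 := sigmoid_sub_mul_ge (a := h (zs i)) (e := e (zs i)) (M := 2 * B)
      ((habs h _).trans (by linarith))
    refine le_trans ?_ h2
    rw [div_mul_eq_mul_div, mul_div_assoc]
    gcongr
    exact habs e _
  have hsmall : ∀ i, |e (zs i)| ≤ 1 / (5 * κ) := fun i => by
    refine abs_le_of_sq_le_sq ?_ (by positivity)
    refine (apply_sq_le_sigma_sq hq hρ zs (zs i) e).trans (le_trans ?_ (hσ i))
    refine mul_le_mul_of_nonneg_left (le_trans ?_ hcons) (sq_nonneg _)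
    rw [← hZ]
    have : 4 * lam ≤ lam * κ := by nlinarith
    gcongr
  -- Sharp pass: `hsmall` lowers the curvature 1/κ by at most 1/(20κ), which leaves 19/(20κ).
  have hfinal : √(‖e‖ ^ 2 + Z / (lam * κ)) ≤ B + √(κ / lam * l) := by
    refine sqrt_energy_le hB hlam hκ hl (norm_nonneg _) hZ0 (le_trans ?_ henergy)
    rw [hZ, Finset.mul_sum]
    refine add_le_add le_rfl (Finset.sum_le_sum fun i _ => ?_)
    refine le_trans ?_ (sigmoid_sub_mul_ge_deriv (h (zs i)) (e (zs i)))
    gcongr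
    have h1 := hderiv i
    have h2 := hsmall i
    have h3 : 19 / 20 / κ = 1 / κ - 1 / (5 * κ) / 4 := by field_simp; norm_num
    rw [h3]
    linarith
  have h1 := abs_sigmoid_sub_le (h w) (g w)
  rw [show g w - h w = e w by simp [he]] at h1
  have h2 : |e w| ≤ sigma q (lam * κ) zs w * √(‖e‖ ^ 2 + Z / (lam * κ)) := by
    refine abs_le_of_sq_le_sq ?_ (mul_nonneg (sigma_nonneg ..) (Real.sqrt_nonneg _))
    rw [mul_pow, Real.sq_sqrt (by positivity)]
    exact apply_sq_le_sigma_sq hq hρ zs w e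
  have h3 := mul_le_mul_of_nonneg_left hfinal (sigma_nonneg q (lam * κ) zs w)
  linarith

end Confidence

/-! ### Uniform concentration of the feedback noise -/

section Concentration

variable {Ω : Type*} {mΩ : MeasurableSpace Ω}

/-- Exponential moment of a weighted sum of adapted Bernoulli variables with parameters that are
constant on an initial event `A`. -/
lemma setIntegral_exp_sum_le {P : Measure Ω} [IsProbabilityMeasure P] {m : ℕ → MeasurableSpace Ω}
    (hmono : Monotone m) (hle : ∀ n, m n ≤ mΩ) {A : Set Ω} (hA : MeasurableSet[m 0] A) {N : ℕ}
    {b : ℕ → Ω → Bool} {p : ℕ → ℝ} (hp : ∀ n, p n ∈ Set.Icc (0 : ℝ) 1)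
    (hb : ∀ n < N, MeasurableSet[m (n + 1)] {ω | b n ω = true})
    (hlaw : ∀ n < N, ∀ᵐ ω ∂P, ω ∈ A →
      (P[Set.indicator {ω | b n ω = true} (fun _ => (1 : ℝ)) | m n]) ω = p n)
    (c : ℕ → ℝ) {n : ℕ} (hn : n ≤ N) :
    Integrable (fun ω => Real.exp (∑ i ∈ Finset.range n,
        c i * ((if b i ω then 1 else 0) - p i))) P ∧
    ∫ ω in A, Real.exp (∑ i ∈ Finset.range n, c i * ((if b i ω then 1 else 0) - p i)) ∂P ≤
      P.real A * Real.exp ((∑ i ∈ Finset.range n, c i ^ 2) / 8) := by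
  have hmeas : ∀ n ≤ N, StronglyMeasurable[m n] fun ω => Real.exp (∑ i ∈ Finset.range n,
      c i * ((if b i ω then 1 else 0) - p i)) := by
    intro n hn
    refine (Measurable.exp ?_).stronglyMeasurable
    refine Finset.measurable_sum _ fun i hi => ?_
    have hi' := Finset.mem_range.1 hi
    refine ((Measurable.ite (hmono (by omega : i + 1 ≤ n) _ (hb i (by omega))) measurable_const
      measurable_const).sub_const _).const_mul _
  have hbd : ∀ n, ∀ ω, ‖Real.exp (∑ i ∈ Finset.range n,
      c i * ((if b i ω then 1 else 0) - p i))‖ ≤ Real.exp (∑ i ∈ Finset.range n, |c i|) := by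
    intro n ω
    rw [Real.norm_eq_abs, Real.abs_exp]
    refine Real.exp_le_exp.2 (Finset.sum_le_sum fun i _ => ?_)
    refine (le_abs_self _).trans ?_
    rw [abs_mul]
    refine mul_le_of_le_one_right (abs_nonneg _) ?_
    rw [abs_le]
    have := hp i
    split_ifs <;> constructor <;> linarith [this.1, this.2]
  have hint : ∀ n ≤ N, Integrable (fun ω => Real.exp (∑ i ∈ Finset.range n,
      c i * ((if b i ω then 1 else 0) - p i))) P := fun n hn =>
    Integrable.of_bound ((hmeas n hn).mono (hle n)).aestronglyMeasurable _
      (Filter.Eventually.of_forall (hbd n))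
  refine ⟨hint n hn, ?_⟩
  induction n with
  | zero => simp
  | succ n ih =>
    have hnN : n < N := by omega
    have hA' : MeasurableSet A := hle 0 _ hA
    set G : Ω → ℝ := fun ω => Real.exp (∑ i ∈ Finset.range n,
      c i * ((if b i ω then 1 else 0) - p i)) with hG
    set J : Ω → ℝ := Set.indicator {ω | b n ω = true} (fun _ => (1 : ℝ)) with hJ
    have hJint : Integrable J P :=
      (integrable_const (1 : ℝ)).indicator (hle (n + 1) _ (hb n hnN))
    have hGint := hint n hnN.le
    have hGJ : Integrable (G * J) P :=
      hJint.bdd_mul ((hmeas n hnN.le).mono (hle n)).aestronglyMeasurable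
        (Filter.Eventually.of_forall (hbd n))
    have hpull := condExp_stronglyMeasurable_mul_of_bound (hle n) (hmeas n hnN.le) hJint _
      (Filter.Eventually.of_forall (hbd n))
    have hGJA : ∫ ω in A, (G * J) ω ∂P = p n * ∫ ω in A, G ω ∂P := by
      rw [← setIntegral_condExp (hle n) hGJ (hmono (Nat.zero_le n) _ hA), ← integral_const_mul]
      refine setIntegral_congr_ae hA' ?_
      filter_upwards [hpull, hlaw n hnN] with ω h1 h2 hω
      rw [h1, Pi.mul_apply, h2 hω, mul_comm]
    -- The exponential of an indicator multiple is affine in the indicator, so the conditional law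
    -- enters linearly.
    have hsplit : ∀ ω, Real.exp (∑ i ∈ Finset.range (n + 1),
        c i * ((if b i ω then 1 else 0) - p i)) =
        Real.exp (-(c n * p n)) * (G ω + (Real.exp (c n) - 1) * (G * J) ω) := by
      intro ω
      rw [Finset.sum_range_succ, Real.exp_add]
      by_cases h : b n ω = true
      · simp only [hG, hJ, Pi.mul_apply, Set.indicator, Set.mem_ofPred_eq, h, if_true]
        rw [show c n * (1 - p n) = -(c n * p n) + c n by ring, Real.exp_add]
        ring
      · simp only [hG, hJ, Pi.mul_apply, Set.indicator, Set.mem_ofPred_eq, h]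
        simp [mul_comm]
    simp only [hsplit]
    rw [integral_const_mul, integral_add hGint.integrableOn (hGJ.const_mul _).integrableOn,
      integral_const_mul, hGJA, Finset.sum_range_succ, add_div, Real.exp_add]
    have h1 := bernoulli_mgf_le (hp n) (c n)
    have h2 : 0 ≤ ∫ ω in A, G ω ∂P := integral_nonneg fun ω => (Real.exp_pos _).le
    rw [show c n * (1 - p n) = -(c n * p n) + c n by ring, Real.exp_add] at h1
    calc _ = (∫ ω in A, G ω ∂P) * (p n * (Real.exp (-(c n * p n)) * Real.exp (c n)) +
            (1 - p n) * Real.exp (-(c n * p n))) := by ring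
      _ ≤ (P.real A * Real.exp ((∑ i ∈ Finset.range n, c i ^ 2) / 8)) *
            Real.exp (c n ^ 2 / 8) := by
          refine mul_le_mul (ih hnN.le) (le_trans (le_of_eq ?_) h1) ?_ (by positivity)
          · ring
          · have h3 := hp n
            have h4 := sub_nonneg.2 h3.2
            have h5 := h3.1
            positivity
      _ = _ := by ring

lemma measure_inter_weighted_sum_ge_le {P : Measure Ω} [IsProbabilityMeasure P]
    {m : ℕ → MeasurableSpace Ω}
    (hmono : Monotone m) (hle : ∀ n, m n ≤ mΩ) {A : Set Ω} (hA : MeasurableSet[m 0] A) {N : ℕ}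
    {b : ℕ → Ω → Bool} {p : ℕ → ℝ} (hp : ∀ n, p n ∈ Set.Icc (0 : ℝ) 1)
    (hb : ∀ n < N, MeasurableSet[m (n + 1)] {ω | b n ω = true})
    (hlaw : ∀ n < N, ∀ᵐ ω ∂P, ω ∈ A →
      (P[Set.indicator {ω | b n ω = true} (fun _ => (1 : ℝ)) | m n]) ω = p n)
    (c : ℕ → ℝ) (hc : ∑ i ∈ Finset.range N, c i ^ 2 ≤ 1) {x : ℝ} (hx : 0 ≤ x) :
    P (A ∩ {ω | x ≤ ∑ i ∈ Finset.range N, c i * ((if b i ω then 1 else 0) - p i)}) ≤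
      P A * ENNReal.ofReal (Real.exp (-(2 * x ^ 2))) := by
  have hA' : MeasurableSet A := hle 0 _ hA
  -- The scale `4 * x` minimizes s²/8 - sx, the Chernoff exponent for unit weights.
  obtain ⟨h1, h2⟩ := setIntegral_exp_sum_le hmono hle hA hp hb hlaw
    (fun i => 4 * x * c i) le_rfl
  have h3 := mul_meas_ge_le_integral_of_nonneg (μ := P.restrict A)
    (Filter.Eventually.of_forall fun ω => (Real.exp_pos _).le) h1.integrableOn
    (Real.exp (4 * x * x))
  have hset : A ∩ {ω | x ≤ ∑ i ∈ Finset.range N, c i * ((if b i ω then 1 else 0) - p i)} ⊆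
      {ω | Real.exp (4 * x * x) ≤ Real.exp (∑ i ∈ Finset.range N,
        4 * x * c i * ((if b i ω then 1 else 0) - p i))} ∩ A := by
    rintro ω ⟨hω, h⟩
    refine ⟨?_, hω⟩
    simp only [Set.mem_ofPred_eq] at h ⊢
    refine Real.exp_le_exp.2 ((mul_le_mul_of_nonneg_left h (by positivity : 0 ≤ 4 * x)).trans
      (le_of_eq ?_))
    rw [Finset.mul_sum]
    exact Finset.sum_congr rfl fun i _ => by ring
  refine (measure_mono hset).trans ?_
  rw [← ENNReal.toReal_le_toReal (measure_ne_top _ _)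
    (ENNReal.mul_ne_top (measure_ne_top _ _) ENNReal.ofReal_ne_top), ENNReal.toReal_mul,
    ENNReal.toReal_ofReal (Real.exp_pos _).le]
  rw [measureReal_def, Measure.restrict_apply' hA'] at h3
  have h4 : (∑ i ∈ Finset.range N, (4 * x * c i) ^ 2) / 8 ≤ 2 * x ^ 2 := by
    simp only [mul_pow (4 * x), ← Finset.mul_sum]
    nlinarith [sq_nonneg x]
  have h5 : P.real A * Real.exp ((∑ i ∈ Finset.range N, (4 * x * c i) ^ 2) / 8) ≤
      P.real A * Real.exp (2 * x ^ 2) := by gcongr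
  have h6 := h3.trans (h2.trans h5)
  have h7 : Real.exp (-(2 * x ^ 2)) = Real.exp (2 * x ^ 2) / Real.exp (4 * x * x) := by
    rw [← Real.exp_sub]; ring_nf
  rw [h7, ← measureReal_def P A, ← mul_div_assoc, le_div_iff₀ (Real.exp_pos _), mul_comm]
  exact h6

/-- A finite set of directions that almost attains the Euclidean norm. -/
lemma exists_norming_finset (S : Type*) [Fintype S] :
    ∃ F : Finset (S → ℝ), (∀ a ∈ F, ∑ w, a w ^ 2 ≤ 1) ∧
      ∀ g : S → ℝ, ∃ a ∈ F, 9 / 10 * √(∑ w, g w ^ 2) ≤ ∑ w, a w * g w := by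
  classical
  -- A net of mesh 1/10 in the unit ball loses at most a tenth of the norm.
  obtain ⟨t, ht, hfin, hcov⟩ := (isCompact_closedBall (0 : EuclideanSpace ℝ S) 1).finite_cover_balls
    (e := 1 / 10) (by norm_num)
  refine ⟨hfin.toFinset.image fun a w => a w, ?_, fun g => ?_⟩
  · simp only [Finset.mem_image, Set.Finite.mem_toFinset, forall_exists_index, and_imp]
    rintro _ a ha rfl
    have h := ht ha
    rw [mem_closedBall_zero_iff] at h
    rw [← EuclideanSpace.real_norm_sq_eq]
    exact pow_le_one₀ (norm_nonneg _) h
  · let v : EuclideanSpace ℝ S := WithLp.toLp 2 g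
    have hv : √(∑ w, g w ^ 2) = ‖v‖ := by
      rw [EuclideanSpace.norm_eq]; simp [v]
    have hu : ‖v‖⁻¹ • v ∈ Metric.closedBall (0 : EuclideanSpace ℝ S) 1 := by
      rw [mem_closedBall_zero_iff, norm_smul, norm_inv, norm_norm]
      exact inv_mul_le_one
    obtain ⟨a, ha, hd⟩ := Set.mem_iUnion₂.1 (hcov hu)
    refine ⟨fun w => a w, by simpa using ⟨a, ha, rfl⟩, ?_⟩
    have h1 : ∑ w, a w * g w = inner ℝ v a := by
      simp [PiLp.inner_apply, v]
    have h2 : inner ℝ v (‖v‖⁻¹ • v) = ‖v‖ := by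
      rw [inner_smul_right, real_inner_self_eq_norm_sq]
      rcases eq_or_ne ‖v‖ 0 with h | h
      · simp [h]
      · field_simp
    have h3 : inner ℝ v (‖v‖⁻¹ • v - a) ≤ ‖v‖ * (1 / 10) := by
      refine (real_inner_le_norm _ _).trans ?_
      gcongr
      rw [← dist_eq_norm]; exact (Metric.mem_ball.1 hd).le
    rw [inner_sub_right, h2] at h3
    rw [hv, h1]
    linarith

/-- The number of occurrences of `w` among the points `zs`. -/
noncomputable def count {S : Type*} [DecidableEq S] {N : ℕ} (zs : Fin N → S) (w : S) : ℝ :=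
  (Finset.univ.filter fun i => zs i = w).card

lemma sum_comp_eq {S : Type*} [Fintype S] [DecidableEq S] {N : ℕ} (zs : Fin N → S)
    (F : Fin N → S → ℝ) :
    ∑ i, F i (zs i) = ∑ w, ∑ i ∈ Finset.univ.filter fun i => zs i = w, F i w := by
  rw [← Finset.sum_fiberwise Finset.univ zs]
  refine Finset.sum_congr rfl fun w _ => Finset.sum_congr rfl fun i hi => ?_
  rw [(Finset.mem_filter.1 hi).2]

/-- Each sampled point contributes `a w ^ 2` in total and the others nothing; this is why weights
are divided by √count. -/
lemma sum_sq_div_count_le {S : Type*} [Fintype S] [DecidableEq S] {N : ℕ} (zs : Fin N → S)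
    (a : S → ℝ) : ∑ i, (a (zs i) / √(count zs (zs i))) ^ 2 ≤ ∑ w, a w ^ 2 := by
  rw [sum_comp_eq zs fun _ w => (a w / √(count zs w)) ^ 2]
  refine Finset.sum_le_sum fun w _ => ?_
  rw [Finset.sum_const, nsmul_eq_mul, div_pow, count, Real.sq_sqrt (Nat.cast_nonneg _),
    ← mul_div_assoc, mul_comm]
  exact div_le_of_le_mul₀ (Nat.cast_nonneg _) (sq_nonneg _) le_rfl

/-- Grouping the noise by point and normalizing by √count yields a vector `g` on `S`. Finitely many
tests bound its norm, and Cauchy–Schwarz then handles every `v`. -/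
lemma sum_noise_mul_le {S : Type*} [Fintype S] [DecidableEq S] {F : Finset (S → ℝ)}
    (hF : ∀ g : S → ℝ, ∃ a ∈ F, 9 / 10 * √(∑ w, g w ^ 2) ≤ ∑ w, a w * g w)
    {N : ℕ} (zs : Fin N → S) (ε : Fin N → ℝ) {s : ℝ} (hs : 0 ≤ s)
    (h : ∀ a ∈ F, ∑ i, a (zs i) / √(count zs (zs i)) * ε i ≤ 9 / 10 * √s) (v : S → ℝ) :
    ∑ i, ε i * v (zs i) ≤ √(s * ∑ i, v (zs i) ^ 2) := by
  let g : S → ℝ := fun w => (∑ i ∈ Finset.univ.filter fun i => zs i = w, ε i) / √(count zs w)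
  have h1 : ∀ a : S → ℝ, ∑ i, a (zs i) / √(count zs (zs i)) * ε i = ∑ w, a w * g w := fun a => by
    rw [sum_comp_eq zs fun i w => a w / √(count zs w) * ε i]
    refine Finset.sum_congr rfl fun w _ => ?_
    rw [← Finset.mul_sum]; simp only [g]; ring
  have h2 : ∑ i, ε i * v (zs i) = ∑ w, g w * (√(count zs w) * v w) := by
    rw [sum_comp_eq zs fun i w => ε i * v w]
    refine Finset.sum_congr rfl fun w _ => ?_
    rw [← Finset.sum_mul, ← mul_assoc]
    congr 1
    rcases (Finset.univ.filter fun i => zs i = w).eq_empty_or_nonempty with h0 | h0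
    · simp [g, h0]
    · have : 0 < count zs w := by
        unfold count; exact_mod_cast h0.card_pos
      simp only [g]
      rw [div_mul_cancel₀ _ (Real.sqrt_pos.2 this).ne']
  have h3 : ∑ i, v (zs i) ^ 2 = ∑ w, (√(count zs w) * v w) ^ 2 := by
    rw [sum_comp_eq zs fun i w => v w ^ 2]
    refine Finset.sum_congr rfl fun w _ => ?_
    rw [mul_pow, count, Real.sq_sqrt (Nat.cast_nonneg _), Finset.sum_const, nsmul_eq_mul]
  obtain ⟨a, ha, hag⟩ := hF g
  have h4 := h a ha
  rw [h1] at h4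
  have h5 : ∑ w, g w ^ 2 ≤ s := by
    have : √(∑ w, g w ^ 2) ≤ √s := by linarith
    exact (Real.sqrt_le_sqrt_iff hs).1 this
  rw [h2, h3]
  refine Real.le_sqrt_of_sq_le ((Finset.sum_mul_sq_le_sq_mul_sq _ _ _).trans ?_)
  gcongr

/-- Uniform noise bound on a batch of points chosen before any of its labels is drawn. -/
theorem measure_exists_noise_gt_le {S : Type*} [Fintype S] [DecidableEq S]
    {F : Finset (S → ℝ)} (hF1 : ∀ a ∈ F, ∑ w, a w ^ 2 ≤ 1)
    (hF : ∀ g : S → ℝ, ∃ a ∈ F, 9 / 10 * √(∑ w, g w ^ 2) ≤ ∑ w, a w * g w)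
    {P : Measure Ω} [IsProbabilityMeasure P] {m : ℕ → MeasurableSpace Ω}
    (hmono : Monotone m) (hle : ∀ n, m n ≤ mΩ) {N : ℕ} {z : ℕ → Ω → S} {b : ℕ → Ω → Bool}
    {p : S → ℝ} (hp : ∀ w, p w ∈ Set.Icc (0 : ℝ) 1)
    (hz : ∀ n < N, ∀ w, MeasurableSet[m 0] {ω | z n ω = w})
    (hb : ∀ n < N, MeasurableSet[m (n + 1)] {ω | b n ω = true})
    (hlaw : ∀ n < N, P[Set.indicator {ω | b n ω = true} (fun _ => (1 : ℝ)) | m n]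
      =ᵐ[P] fun ω => p (z n ω)) {s : ℝ} (hs : 0 ≤ s) :
    P {ω | ¬ ∀ v : S → ℝ, ∑ i : Fin N, ((if b i ω then 1 else 0) - p (z i ω)) * v (z i ω) ≤
        √(s * ∑ i : Fin N, v (z i ω) ^ 2)} ≤
      ENNReal.ofReal (F.card * Real.exp (-(81 / 50 * s))) := by
  classical
  -- The batch is fixed before its labels, so on each `A zs` the weights are deterministic.
  let A : (Fin N → S) → Set Ω := fun zs => (fun ω (i : Fin N) => z i ω) ⁻¹' {zs}
  have hA : ∀ zs, MeasurableSet[m 0] (A zs) := fun zs => by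
    have : A zs = ⋂ i : Fin N, {ω | z i ω = zs i} := by
      ext ω; simp [A, funext_iff]
    rw [this]
    exact MeasurableSet.iInter fun i => hz i i.2 _
  let W : (Fin N → S) → (S → ℝ) → Set Ω := fun zs a => {ω | 9 / 10 * √s ≤
    ∑ i : Fin N, a (zs i) / √(count zs (zs i)) * ((if b i ω then 1 else 0) - p (zs i))}
  have hW : ∀ zs, ∀ a ∈ F, P (A zs ∩ W zs a) ≤
      P (A zs) * ENNReal.ofReal (Real.exp (-(81 / 50 * s))) := by
    intro zs a ha
    rcases Nat.eq_zero_or_pos N with rfl | hN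
    · rcases hs.eq_or_lt with rfl | hs0
      · simpa using measure_mono Set.inter_subset_left
      · have : W zs a = ∅ := by
          ext ω; simp only [W, Finset.univ_eq_empty, Finset.sum_empty, Set.mem_ofPred_eq,
            Set.mem_empty_iff_false, iff_false, not_le]
          have := Real.sqrt_pos.2 hs0
          positivity
        simp [this]
    -- Periodic extension of the batch to all indices; only those below `N` matter.
    let e : ℕ → Fin N := fun n => ⟨n % N, Nat.mod_lt _ hN⟩
    have he : ∀ i : Fin N, e i = i := fun i => Fin.ext (Nat.mod_eq_of_lt i.2)
    let zs' : ℕ → S := fun n => zs (e n)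
    have hzs' : ∀ i : Fin N, zs' i = zs i := fun i => by simp only [zs', he]
    have h := measure_inter_weighted_sum_ge_le hmono hle (hA zs) (p := fun n => p (zs' n))
      (fun n => hp _) hb (fun n hn => by
        filter_upwards [hlaw n hn] with ω h1 h2
        rw [h1]
        have h3 : z n ω = zs ⟨n, hn⟩ := congrFun h2 ⟨n, hn⟩
        rw [h3, ← hzs' ⟨n, hn⟩])
      (fun n => a (zs' n) / √(count zs (zs' n))) (by
        rw [← Fin.sum_univ_eq_sum_range (fun n => (a (zs' n) / √(count zs (zs' n))) ^ 2)]
        simp only [hzs']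
        exact (sum_sq_div_count_le zs a).trans (hF1 a ha))
      (x := 9 / 10 * √s) (by positivity)
    rw [mul_pow, Real.sq_sqrt hs, show 2 * ((9 / 10 : ℝ) ^ 2 * s) = 81 / 50 * s by ring] at h
    refine le_trans (le_of_eq ?_) h
    congr 3
    ext ω
    simp only [W, Set.mem_ofPred_eq]
    rw [← Fin.sum_univ_eq_sum_range (fun n => a (zs' n) / √(count zs (zs' n)) *
      ((if b n ω then 1 else 0) - p (zs' n)))]
    simp only [hzs']
  have hsub : {ω | ¬ ∀ v : S → ℝ, ∑ i : Fin N, ((if b i ω then 1 else 0) - p (z i ω)) * v (z i ω) ≤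
      √(s * ∑ i : Fin N, v (z i ω) ^ 2)} ⊆ ⋃ zs ∈ (Finset.univ : Finset (Fin N → S)),
        ⋃ a ∈ F, A zs ∩ W zs a := by
    intro ω hω
    by_contra hcon
    refine hω fun v => ?_
    refine sum_noise_mul_le hF (fun i : Fin N => z i ω) _ hs (fun a ha => ?_) v
    by_contra hlt
    refine hcon (Set.mem_iUnion₂.2 ⟨fun i => z i ω, Finset.mem_univ _,
      Set.mem_iUnion₂.2 ⟨a, ha, rfl, ?_⟩⟩)
    exact (not_le.1 hlt).le
  refine (measure_mono hsub).trans ((measure_biUnion_finset_le _ _).trans ?_)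
  -- The events `A zs` are disjoint, so the sum over batches costs no factor; only the size of `F`
  -- remains.
  calc ∑ zs, P (⋃ a ∈ F, A zs ∩ W zs a)
      ≤ ∑ zs, ∑ a ∈ F, P (A zs) * ENNReal.ofReal (Real.exp (-(81 / 50 * s))) :=
        Finset.sum_le_sum fun zs _ => (measure_biUnion_finset_le _ _).trans
          (Finset.sum_le_sum fun a ha => hW zs a ha)
    _ = (∑ zs, P (A zs)) * (F.card * ENNReal.ofReal (Real.exp (-(81 / 50 * s)))) := by
        rw [Finset.sum_mul]
        refine Finset.sum_congr rfl fun zs _ => ?_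
        rw [Finset.sum_const, nsmul_eq_mul]; ring
    _ ≤ 1 * (F.card * ENNReal.ofReal (Real.exp (-(81 / 50 * s)))) := by
        gcongr
        rw [sum_measure_preimage_singleton _ fun zs _ => hle 0 _ (hA zs)]
        exact prob_le_one
    _ = _ := by
        rw [one_mul, ENNReal.ofReal_mul (Nat.cast_nonneg _), ENNReal.ofReal_natCast]

end Concentration

open Filter Topology

/-! ### Round lengths, number of rounds and asymptotics -/

section Rounds

lemma fullLen_succ_of_pos (T : ℕ) {r : ℕ} (hr : 1 ≤ r) :
    fullLen T (r + 1) = ⌈√((fullLen T r : ℝ) * (T : ℝ))⌉₊ := by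
  obtain ⟨j, rfl⟩ := Nat.exists_eq_add_of_le' hr
  rfl

lemma sqrt_le_fullLen {T : ℕ} (hT : 1 ≤ T) {r : ℕ} (hr : 1 ≤ r) : √(T : ℝ) ≤ fullLen T r := by
  induction r, hr using Nat.le_induction with
  | base => exact Nat.le_ceil _
  | succ r hr ih =>
    rw [fullLen_succ_of_pos T hr]
    refine le_trans (Real.sqrt_le_sqrt ?_) (Nat.le_ceil _)
    have h1 : (1 : ℝ) ≤ √(T : ℝ) := Real.one_le_sqrt.2 (by exact_mod_cast hT)
    exact le_mul_of_one_le_left (Nat.cast_nonneg _) (h1.trans ih)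

lemma one_le_fullLen {T : ℕ} (hT : 1 ≤ T) {r : ℕ} (hr : 1 ≤ r) : 1 ≤ fullLen T r := by
  have h1 : (1 : ℝ) ≤ √(T : ℝ) := Real.one_le_sqrt.2 (by exact_mod_cast hT)
  exact_mod_cast h1.trans (sqrt_le_fullLen hT hr)

lemma fullLen_one_le (T : ℕ) : (fullLen T 1 : ℝ) ≤ √T + 1 :=
  (Nat.ceil_lt_add_one (Real.sqrt_nonneg _)).le

lemma fullLen_succ_le (T : ℕ) {r : ℕ} (hr : 1 ≤ r) :
    (fullLen T (r + 1) : ℝ) ≤ √(fullLen T r) * √T + 1 := by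
  rw [fullLen_succ_of_pos T hr, ← Real.sqrt_mul (Nat.cast_nonneg _)]
  exact (Nat.ceil_lt_add_one (Real.sqrt_nonneg _)).le

/-- If `x ^ (2 ^ r) ≥ T` then the nominal length of round `r` is at least `T / x`. -/
lemma le_fullLen_mul {T r : ℕ} (hr : 1 ≤ r) {x : ℝ} (hx : 0 ≤ x) (h : (T : ℝ) ≤ x ^ 2 ^ r) :
    (T : ℝ) ≤ fullLen T r * x := by
  induction r, hr using Nat.le_induction generalizing x with
  | base =>
    have h1 : √(T : ℝ) ≤ x := Real.sqrt_le_iff.2 ⟨hx, by simpa using h⟩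
    have h2 : √(T : ℝ) ≤ fullLen T 1 := Nat.le_ceil _
    calc (T : ℝ) = √T * √T := (Real.mul_self_sqrt (Nat.cast_nonneg _)).symm
      _ ≤ _ := mul_le_mul h2 h1 (Real.sqrt_nonneg _) (Nat.cast_nonneg _)
  | succ r hr ih =>
    -- The recursion halves the exponent, so the previous round is used with `x ^ 2`.
    have h1 := ih (sq_nonneg x) (by rwa [← pow_mul, mul_comm, ← pow_succ])
    have h2 : √((fullLen T r : ℝ) * T) ≤ fullLen T (r + 1) := by
      rw [fullLen_succ_of_pos T hr]; exact Nat.le_ceil _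
    have h3 := (Real.sqrt_le_iff.1 h2).2
    refine le_of_sq_le_sq ?_ (by positivity)
    calc (T : ℝ) ^ 2 ≤ (fullLen T r * x ^ 2) * T := by rw [sq]; gcongr
      _ = fullLen T r * T * x ^ 2 := by ring
      _ ≤ fullLen T (r + 1) ^ 2 * x ^ 2 := by gcongr
      _ = _ := by ring

lemma le_sum_fullLen_numRounds {T : ℕ} (hT : 1 ≤ T) :
    T ≤ ∑ j ∈ Finset.range (numRounds T + 1), fullLen T j := by
  refine Nat.sInf_mem (s := {R : ℕ | T ≤ ∑ j ∈ Finset.range (R + 1), fullLen T j}) ⟨T, ?_⟩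
  rw [Set.mem_ofPred_eq, Finset.sum_range_succ']
  calc T = ∑ j ∈ Finset.range T, 1 := by simp
    _ ≤ ∑ j ∈ Finset.range T, fullLen T (j + 1) :=
        Finset.sum_le_sum fun j _ => one_le_fullLen hT (by omega)
    _ ≤ _ := Nat.le_add_right _ _

lemma numRounds_le_of_le_sum {T R : ℕ} (h : T ≤ ∑ j ∈ Finset.range (R + 1), fullLen T j) :
    numRounds T ≤ R := Nat.sInf_le h

lemma sum_fullLen_lt {T r : ℕ} (hr : r < numRounds T) :
    ∑ j ∈ Finset.range (r + 1), fullLen T j < T :=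
  not_le.1 (Nat.notMem_of_lt_sInf (s := {R : ℕ | T ≤ ∑ j ∈ Finset.range (R + 1), fullLen T j}) hr)

lemma roundLen_eq_fullLen {T r : ℕ} (hr : r < numRounds T) : roundLen T r = fullLen T r := by
  have := sum_fullLen_lt hr
  rw [Finset.sum_range_succ] at this
  rw [roundLen, roundStart]
  omega

lemma roundLen_le_fullLen (T r : ℕ) : roundLen T r ≤ fullLen T r := min_le_left _ _

lemma roundStart_add_roundLen (T r : ℕ) : roundStart T r + roundLen T r = roundStart T (r + 1) := by
  rw [roundLen, roundStart, roundStart, Finset.sum_range_succ]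
  omega

lemma roundStart_add_roundLen_le (T r : ℕ) : roundStart T r + roundLen T r ≤ T := by
  rw [roundStart_add_roundLen]; exact min_le_left _ _

lemma sum_range_roundStart {T : ℕ} (g : ℕ → ℝ) (R : ℕ) :
    ∑ t ∈ Finset.range (roundStart T R), g t =
      ∑ r ∈ Finset.range R, ∑ n ∈ Finset.range (roundLen T r), g (roundStart T r + n) := by
  induction R with
  | zero => simp [roundStart]
  | succ R ih =>
    rw [Finset.sum_range_succ, ← ih, ← roundStart_add_roundLen, Finset.sum_range_add]

/-- Time steps are partitioned into rounds. -/
lemma sum_range_eq_sum_rounds {T : ℕ} (hT : 1 ≤ T) (g : ℕ → ℝ) :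
    ∑ t ∈ Finset.range T, g t = ∑ r ∈ Finset.range (numRounds T),
      ∑ n ∈ Finset.range (roundLen T (r + 1)), g (roundStart T (r + 1) + n) := by
  have h : roundStart T (numRounds T + 1) = T := min_eq_left (le_sum_fullLen_numRounds hT)
  conv_lhs => rw [← h]
  rw [sum_range_roundStart, Finset.sum_range_succ']
  have : roundLen T 0 = 0 := by simp [roundLen, fullLen]
  simp [this]

theorem numRounds_le {T : ℕ} (hT : 4 ≤ T) :
    (numRounds T : ℤ) ≤ ⌈Real.logb 2 (Real.logb 2 (T : ℝ))⌉ + 1 := by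
  have hT' : (4 : ℝ) ≤ T := by exact_mod_cast hT
  have h1 : 2 ≤ Real.logb 2 (T : ℝ) := by
    rw [Real.le_logb_iff_rpow_le (by norm_num) (by linarith)]; norm_num; exact hT
  have h2 : 1 ≤ Real.logb 2 (Real.logb 2 (T : ℝ)) := by
    rw [Real.le_logb_iff_rpow_le (by norm_num) (by linarith)]; simpa using h1
  obtain ⟨J, hJ⟩ := Int.eq_ofNat_of_zero_le
    (Int.ceil_nonneg (by linarith : 0 ≤ Real.logb 2 (Real.logb 2 (T : ℝ))))
  have hJl : Real.logb 2 (Real.logb 2 (T : ℝ)) ≤ J := by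
    have := Int.le_ceil (Real.logb 2 (Real.logb 2 (T : ℝ)))
    rw [hJ] at this; exact_mod_cast this
  -- Index 0 has length 0; `J ≥ 1` makes both J and J + 1 genuine rounds, each of length at least
  -- T/2.
  have hJ1 : 1 ≤ J := by exact_mod_cast h2.trans hJl
  have h3 : Real.logb 2 (T : ℝ) ≤ ((2 ^ J : ℕ) : ℝ) := by
    have := (Real.logb_le_iff_le_rpow (by norm_num) (by linarith)).1 hJl
    rw [Real.rpow_natCast] at this
    exact_mod_cast this
  have h4 : (T : ℝ) ≤ 2 ^ 2 ^ J := by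
    have := (Real.logb_le_iff_le_rpow (by norm_num) (by linarith)).1 h3
    rwa [Real.rpow_natCast] at this
  have h5 := le_fullLen_mul hJ1 zero_le_two h4
  have h6 := le_fullLen_mul (T := T) (r := J + 1) (by omega) zero_le_two
    (h4.trans (pow_le_pow_right₀ one_le_two (Nat.pow_le_pow_right two_pos (Nat.le_succ J))))
  rw [hJ]
  have h7 : numRounds T ≤ J + 1 := by
    refine numRounds_le_of_le_sum ?_
    rw [Finset.sum_range_succ, Finset.sum_range_succ]
    have h8 : T ≤ fullLen T J * 2 := by exact_mod_cast h5
    have h9 : T ≤ fullLen T (J + 1) * 2 := by exact_mod_cast h6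
    omega
  exact_mod_cast h7

/-- Every fixed round is negligible against the horizon, so no fixed number of rounds suffices. -/
lemma tendsto_fullLen_div (r : ℕ) :
    Tendsto (fun T : ℕ => (fullLen T r : ℝ) / T) atTop (𝓝 0) := by
  have hinv : Tendsto (fun T : ℕ => (1 : ℝ) / T) atTop (𝓝 0) := tendsto_one_div_atTop_nhds_zero_nat
  have hsqrt : ∀ u : ℕ → ℝ, Tendsto u atTop (𝓝 0) →
      Tendsto (fun T => √(u T) + 1 / (T : ℝ)) atTop (𝓝 0) := fun u hu => by
    simpa using (hu.sqrt).add hinv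
  match r with
  | 0 => simp [fullLen]
  | 1 =>
    refine squeeze_zero' (Eventually.of_forall fun T => by positivity) ?_ (hsqrt _ hinv)
    filter_upwards [eventually_gt_atTop 0] with T hT
    have hT' : (0 : ℝ) < T := by exact_mod_cast hT
    rw [div_le_iff₀ hT', add_mul, one_div_mul_cancel hT'.ne']
    refine (fullLen_one_le T).trans (add_le_add (le_of_eq ?_) le_rfl)
    rw [Real.sqrt_div zero_le_one, Real.sqrt_one, div_mul_eq_mul_div, one_mul, Real.div_sqrt]
  | r + 2 =>
    refine squeeze_zero' (Eventually.of_forall fun T => by positivity) ?_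
      (hsqrt _ (tendsto_fullLen_div (r + 1)))
    filter_upwards [eventually_gt_atTop 0] with T hT
    have hT' : (0 : ℝ) < T := by exact_mod_cast hT
    rw [div_le_iff₀ hT', add_mul, one_div_mul_cancel hT'.ne']
    refine (fullLen_succ_le T (by omega)).trans (add_le_add (le_of_eq ?_) le_rfl)
    rw [Real.sqrt_div (Nat.cast_nonneg _), div_mul_eq_mul_div, mul_div_assoc, Real.div_sqrt]

theorem tendsto_numRounds : Tendsto numRounds atTop atTop := by
  refine tendsto_atTop.2 fun K => ?_
  have h : Tendsto (fun T : ℕ => ∑ j ∈ Finset.range (K + 1), (fullLen T j : ℝ) / T) atTop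
      (𝓝 0) := by
    simpa using tendsto_finsetSum (Finset.range (K + 1)) fun j _ => tendsto_fullLen_div j
  filter_upwards [h.eventually (gt_mem_nhds one_pos), eventually_gt_atTop 0] with T h1 hT
  have hT' : (0 : ℝ) < T := by exact_mod_cast hT
  rw [← Finset.sum_div, div_lt_one hT'] at h1
  have h2 : ∑ j ∈ Finset.range (K + 1), fullLen T j < T := by exact_mod_cast h1
  by_contra hcon
  have h3 := le_sum_fullLen_numRounds hT
  have h4 : ∑ j ∈ Finset.range (numRounds T + 1), fullLen T j ≤
      ∑ j ∈ Finset.range (K + 1), fullLen T j :=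
    Finset.sum_le_sum_of_subset (Finset.range_subset_range.2 (by omega))
  omega

lemma tendsto_log_natCast : Tendsto (fun T : ℕ => Real.log T) atTop atTop :=
  Real.tendsto_log_atTop.comp tendsto_natCast_atTop_atTop

theorem tendsto_numRounds_sq_div_log :
    Tendsto (fun T : ℕ => (numRounds T : ℝ) ^ 2 / Real.log T) atTop (𝓝 0) := by
  have hl2 : 0 < Real.log 2 := Real.log_pos one_lt_two
  -- Here `u` stands for log T, and the bracket is the iterated-logarithm bound on the number of
  -- rounds.
  have h1 : Tendsto (fun u : ℝ => ((Real.log u - Real.log (Real.log 2)) / Real.log 2 + 2) ^ 2 / u)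
      atTop (𝓝 0) := by
    have h2 : Tendsto (fun u : ℝ => Real.log u / u ^ (1 / 2 : ℝ)) atTop (𝓝 0) :=
      (isLittleO_log_rpow_atTop (by norm_num)).tendsto_div_nhds_zero
    have h3 : Tendsto (fun u : ℝ => 1 / u ^ (1 / 2 : ℝ)) atTop (𝓝 0) := by
      refine (tendsto_rpow_atTop (by norm_num : (0 : ℝ) < 1 / 2)).inv_tendsto_atTop.congr
        fun u => ?_
      simp
    have h4 := ((((h2.sub (h3.const_mul (Real.log (Real.log 2)))).div_const (Real.log 2)).add
      (h3.const_mul 2)).pow 2)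
    simp only [mul_zero, sub_zero, zero_div, add_zero, zero_pow two_ne_zero] at h4
    refine h4.congr' ?_
    filter_upwards [eventually_gt_atTop 0] with u hu
    have h5 : (u ^ (1 / 2 : ℝ)) ^ 2 = u := by
      rw [← Real.rpow_natCast, ← Real.rpow_mul hu.le]; norm_num
    have h6 : 0 < u ^ (1 / 2 : ℝ) := Real.rpow_pos_of_pos hu _
    set v := u ^ (1 / 2 : ℝ)
    rw [← h5, Real.log_pow]
    field_simp
  have h7 := h1.comp tendsto_log_natCast
  refine squeeze_zero' ?_ ?_ h7
  · filter_upwards [eventually_ge_atTop 1] with T hT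
    have := Real.log_nonneg (by exact_mod_cast hT : (1 : ℝ) ≤ T)
    positivity
  · filter_upwards [eventually_ge_atTop 4] with T hT
    have hT' : (4 : ℝ) ≤ T := by exact_mod_cast hT
    have hlog : 0 < Real.log T := Real.log_pos (by linarith)
    have h8 : (numRounds T : ℝ) ≤
        (Real.log (Real.log T) - Real.log (Real.log 2)) / Real.log 2 + 2 := by
      have h9 : ((numRounds T : ℤ) : ℝ) ≤ ((⌈Real.logb 2 (Real.logb 2 (T : ℝ))⌉ + 1 : ℤ) : ℝ) := by
        exact_mod_cast numRounds_le hT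
      have h10 := (Int.ceil_lt_add_one (Real.logb 2 (Real.logb 2 (T : ℝ)))).le
      rw [← Real.log_div hlog.ne' hl2.ne']
      push_cast at h9
      rw [Real.logb, Real.logb] at h9 h10
      linarith
    simp only [Function.comp]
    gcongr

/-- The logarithm in the confidence width. -/
noncomputable def confLog (N : ℕ) (δ : ℝ) (T : ℕ) : ℝ :=
  Real.log (2 * (numRounds T : ℝ) * (N : ℝ) / δ)

lemma tendsto_confLog {N : ℕ} (hN : 0 < N) {δ : ℝ} (hδ : 0 < δ) :
    Tendsto (confLog N δ) atTop atTop := by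
  have hN' : (0 : ℝ) < N := by exact_mod_cast hN
  refine Real.tendsto_log_atTop.comp ?_
  have h : Tendsto (fun T => (2 * N / δ) * (numRounds T : ℝ)) atTop atTop :=
    (tendsto_natCast_atTop_atTop.comp tendsto_numRounds).const_mul_atTop (by positivity)
  refine h.congr fun T => ?_
  ring

lemma confLog_le {N : ℕ} (hN : 0 < N) {δ : ℝ} (hδ : δ ∈ Set.Ioo (0 : ℝ) 1) {T : ℕ}
    (hR : 1 ≤ numRounds T) :
    confLog N δ T ≤ (Real.log (2 * N / δ) + 1) * numRounds T := by
  have hN' : (1 : ℝ) ≤ N := by exact_mod_cast hN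
  have hR' : (1 : ℝ) ≤ numRounds T := by exact_mod_cast hR
  have hδ0 := hδ.1
  have h0 : 0 ≤ Real.log (2 * N / δ) := by
    refine Real.log_nonneg ?_
    rw [le_div_iff₀ hδ0]
    nlinarith [hδ.2]
  rw [confLog, show 2 * (numRounds T : ℝ) * N / δ = 2 * N / δ * numRounds T by ring,
    Real.log_mul (by positivity) (by positivity)]
  have := Real.log_le_self (by linarith : (0 : ℝ) ≤ numRounds T)
  nlinarith

lemma tendsto_numRounds_mul_confLog_div_log {N : ℕ} (hN : 0 < N) {δ : ℝ}
    (hδ : δ ∈ Set.Ioo (0 : ℝ) 1) :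
    Tendsto (fun T : ℕ => numRounds T * confLog N δ T / Real.log T) atTop (𝓝 0) := by
  have h := tendsto_numRounds_sq_div_log.const_mul (Real.log (2 * N / δ) + 1)
  rw [mul_zero] at h
  refine squeeze_zero' ?_ ?_ h
  · filter_upwards [(tendsto_confLog hN hδ.1).eventually_ge_atTop 0, eventually_ge_atTop 1]
      with T h1 hT
    have := Real.log_nonneg (by exact_mod_cast hT : (1 : ℝ) ≤ T)
    positivity
  · filter_upwards [tendsto_numRounds.eventually_ge_atTop 1, eventually_ge_atTop 1] with T h1 hT
    have h2 := Real.log_nonneg (by exact_mod_cast hT : (1 : ℝ) ≤ T)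
    rw [← mul_div_assoc]
    refine div_le_div_of_nonneg_right ?_ h2
    have := mul_le_mul_of_nonneg_left (confLog_le hN hδ h1) (Nat.cast_nonneg (numRounds T))
    linarith

/-- Eventually the confidence logarithm is below log T. The cube matches the crude consistency
bound, and √T is the least nominal round length. -/
lemma tendsto_confLog_pow_div_sqrt {N : ℕ} (hN : 0 < N) {δ : ℝ} (hδ : δ ∈ Set.Ioo (0 : ℝ) 1) :
    Tendsto (fun T : ℕ => confLog N δ T ^ 3 / √T) atTop (𝓝 0) := by
  have h1 : Tendsto (fun u : ℝ => Real.log u ^ 3 / u ^ (1 / 2 : ℝ)) atTop (𝓝 0) := by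
    have := (isLittleO_log_rpow_rpow_atTop 3 (by norm_num : (0 : ℝ) < 1 / 2)).tendsto_div_nhds_zero
    exact_mod_cast this
  have h2 := h1.comp (tendsto_natCast_atTop_atTop (R := ℝ))
  refine squeeze_zero' ?_ ?_ h2
  · filter_upwards [(tendsto_confLog hN hδ.1).eventually_ge_atTop 0] with T h1
    positivity
  · filter_upwards [(tendsto_confLog hN hδ.1).eventually_ge_atTop 0,
      (tendsto_numRounds_mul_confLog_div_log hN hδ).eventually (gt_mem_nhds one_pos),
      tendsto_numRounds.eventually_ge_atTop 1, eventually_ge_atTop 2] with T h3 h4 h5 hT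
    have h6 : 0 < Real.log T := Real.log_pos (by exact_mod_cast hT)
    rw [div_lt_one h6] at h4
    have h7 : (1 : ℝ) ≤ numRounds T := by exact_mod_cast h5
    simp only [Function.comp]
    rw [← Real.sqrt_eq_rpow]
    gcongr
    nlinarith

end Rounds

/-! ### Confidence widths and the large-horizon conditions -/

section Width

variable {X : Type*}

lemma lipConst_eq [Finite X] [Nonempty X] (f : X → ℝ) : lipConst f = 1 / 4 := by
  refine le_antisymm (ciSup_le fun p => deriv_sigmoid_le _) ?_
  obtain ⟨x⟩ := ‹Nonempty X›
  refine le_trans (le_of_eq ?_) (le_ciSup (Set.finite_range _).bddAbove (x, x))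
  simp [deriv_sigmoid_zero]

lemma beta_eq [Fintype X] [Nonempty X] (f : X → ℝ) (B lam δ : ℝ) (T r : ℕ) : beta f B lam δ T r =
    1 / 4 * (B + √(kappaRound f r / lam * confLog (Fintype.card X) δ T)) := by
  rw [beta, lipConst_eq, confLog]

lemma inv_kappa_le [Finite X] (f : X → ℝ) (x x' : X) :
    1 / kappa f ≤ deriv Real.sigmoid (f x - f x') := by
  have h : 1 / deriv Real.sigmoid (f x - f x') ≤ kappa f :=
    le_ciSup (f := fun p : X × X => 1 / deriv Real.sigmoid (f p.1 - f p.2))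
      (Set.finite_range _).bddAbove (x, x')
  exact one_div_le (deriv_sigmoid_pos _)
    (lt_of_lt_of_le (one_div_pos.2 (deriv_sigmoid_pos _)) h) |>.1 h

lemma four_le_kappa [Finite X] [Nonempty X] (f : X → ℝ) : 4 ≤ kappa f := by
  obtain ⟨x⟩ := ‹Nonempty X›
  refine le_trans (le_of_eq ?_) (le_ciSup (Set.finite_range _).bddAbove (x, x))
  simp [deriv_sigmoid_zero]

/-- A bound on κ uniform in the utility, needed for a threshold independent of `f`. -/
lemma kappa_le [Nonempty X] {f : X → ℝ} {M : ℝ} (h : ∀ x x', |f x - f x'| ≤ M) :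
    kappa f ≤ 1 / deriv Real.sigmoid M :=
  ciSup_le fun _ => one_div_le_one_div_of_le (deriv_sigmoid_pos _)
    (deriv_sigmoid_le_of_abs_le (h _ _))

lemma four_le_kappaRound [Finite X] [Nonempty X] (f : X → ℝ) (r : ℕ) : 4 ≤ kappaRound f r := by
  unfold kappaRound
  split_ifs
  · exact four_le_kappa f
  · norm_num

lemma kappaRound_le {f : X → ℝ} {κ : ℝ} (h6 : 6 ≤ κ) (h : kappa f ≤ κ) (r : ℕ) :
    kappaRound f r ≤ κ := by
  unfold kappaRound
  split_ifs <;> assumption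

lemma beta_nonneg [Fintype X] [Nonempty X] (f : X → ℝ) {B lam δ : ℝ} (hB : 0 < B) (T r : ℕ) :
    0 ≤ beta f B lam δ T r := by
  rw [beta_eq]; positivity

lemma beta_le [Fintype X] [Nonempty X] {f : X → ℝ} {κ : ℝ} (h6 : 6 ≤ κ) (h : kappa f ≤ κ)
    {B lam δ : ℝ} (hlam : 0 < lam)
    {T : ℕ} (hl : 0 ≤ confLog (Fintype.card X) δ T) (r : ℕ) :
    beta f B lam δ T r ≤ 1 / 4 * (B + √(κ / lam * confLog (Fintype.card X) δ T)) := by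
  rw [beta_eq]
  gcongr
  exact kappaRound_le h6 h r

/-- The first width involves κ while the last involves 6. The wasteful factor κ is harmless, being
absorbed later by √Γ. -/
lemma beta_le_mul_beta [Fintype X] [Nonempty X] {f : X → ℝ} {κ : ℝ} (h6 : 6 ≤ κ)
    (h : kappa f ≤ κ) {B lam δ : ℝ}
    (hB : 0 < B) (hlam : 0 < lam) {T : ℕ} (hl : 0 ≤ confLog (Fintype.card X) δ T) (r : ℕ) {R : ℕ}
    (hR : 2 ≤ R) : beta f B lam δ T r ≤ κ * beta f B lam δ T R := by
  refine (beta_le h6 h hlam hl r).trans ?_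
  rw [beta_eq, kappaRound, if_neg (by omega)]
  set l := confLog (Fintype.card X) δ T
  have h1 : √(κ / lam * l) ≤ κ * √(6 / lam * l) := by
    rw [Real.sqrt_le_iff]
    refine ⟨by positivity, ?_⟩
    rw [mul_pow, Real.sq_sqrt (by positivity)]
    calc κ / lam * l ≤ (κ ^ 2 * 6) / lam * l := by gcongr; nlinarith
      _ = _ := by ring
  nlinarith

/-- Conditions on the horizon under which the analysis of the algorithm applies: `N` is the number
of actions, `κ` bounds the curvature constants and `m` is the size of a norming set. -/
structure IsLargeHorizon (N m : ℕ) (B lam δ κ : ℝ) (T : ℕ) : Prop where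
  four_le : 4 ≤ T
  two_le_numRounds : 2 ≤ numRounds T
  sample : 2 * ((N : ℝ) * N) ≤ √T
  one_le_confLog : 1 ≤ confLog N δ T
  bias : B ^ 2 * lam ≤ 4 * confLog N δ T
  norming : (m : ℝ) ≤ Real.exp (confLog N δ T / 4)
  consistency : 2 * (lam * κ) * (N * N) / √T * (consistencyConst B lam
    (deriv Real.sigmoid (2 * B + 1)) * confLog N δ T ^ 3) ≤ (1 / (5 * κ)) ^ 2
  -- The bound 1/12 is 1/4 - 1/6: it makes the curvature constant 6 valid after the first round.
  gap : 4 * (1 / 4 * (B + √(κ / lam * confLog N δ T))) ^ 2 *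
    (2 * (lam * κ) * (N * N) / √T) ≤ 1 / 12

lemma eventually_isLargeHorizon {N : ℕ} (hN : 0 < N) (m : ℕ) {B lam δ κ : ℝ} (hB : 0 < B)
    (hlam : 0 < lam) (hδ : δ ∈ Set.Ioo (0 : ℝ) 1) (hκ : 0 < κ) :
    ∀ᶠ T in atTop, IsLargeHorizon N m B lam δ κ T := by
  have hl := tendsto_confLog hN hδ.1
  have hpow := tendsto_confLog_pow_div_sqrt hN hδ
  have hsqrt : Tendsto (fun T : ℕ => √(T : ℝ)) atTop atTop :=
    Real.tendsto_sqrt_atTop.comp tendsto_natCast_atTop_atTop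
  have h1 := hpow.const_mul (2 * (lam * κ) * (N * N) * consistencyConst B lam
    (deriv Real.sigmoid (2 * B + 1)))
  have h2 := hpow.const_mul (4 * (B + √(κ / lam)) ^ 2 * (2 * (lam * κ) * (N * N)))
  rw [mul_zero] at h1 h2
  filter_upwards [eventually_ge_atTop 4, tendsto_numRounds.eventually_ge_atTop 2,
    hsqrt.eventually_ge_atTop (2 * ((N : ℝ) * N)), hl.eventually_ge_atTop 1,
    hl.eventually_ge_atTop (B ^ 2 * lam / 4), hl.eventually_ge_atTop (4 * Real.log m),
    h1.eventually (gt_mem_nhds (show 0 < (1 / (5 * κ)) ^ 2 by positivity)),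
    h2.eventually (gt_mem_nhds (show (0 : ℝ) < 1 / 12 by norm_num))]
    with T a1 a2 a3 a4 a5 a6 a7 a8
  refine ⟨a1, a2, a3, a4, by linarith, ?_, le_trans (le_of_eq (by ring)) a7.le, ?_⟩
  · rcases Nat.eq_zero_or_pos m with rfl | hm
    · simpa using (Real.exp_pos _).le
    · rw [← Real.log_le_iff_le_exp (by exact_mod_cast hm)]
      linarith
  · refine le_trans ?_ a8.le
    set l := confLog N δ T
    have h3 : 1 / 4 * (B + √(κ / lam * l)) ≤ (B + √(κ / lam)) * √l := by
      have : 1 ≤ √l := Real.one_le_sqrt.2 a4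
      rw [Real.sqrt_mul (by positivity)]
      nlinarith [mul_nonneg hB.le (sub_nonneg.2 this), Real.sqrt_nonneg (κ / lam),
        mul_nonneg (Real.sqrt_nonneg (κ / lam)) (Real.sqrt_nonneg l)]
    have h4 : (1 / 4 * (B + √(κ / lam * l))) ^ 2 ≤ (B + √(κ / lam)) ^ 2 * l ^ 3 := by
      calc _ ≤ ((B + √(κ / lam)) * √l) ^ 2 := by gcongr
        _ = (B + √(κ / lam)) ^ 2 * l := by rw [mul_pow, Real.sq_sqrt (by linarith)]
        _ ≤ _ := by gcongr; exact le_self_pow₀ a4 (by norm_num)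
    calc _ ≤ 4 * ((B + √(κ / lam)) ^ 2 * l ^ 3) * (2 * (lam * κ) * (N * N) / √T) := by gcongr
      _ = _ := by ring

end Width

/-! ### Analysis of a run on the small-noise event -/

section Run

variable {X : Type*} [Fintype X] [DecidableEq X] [Nonempty X]
  {D : Type*} [NormedAddCommGroup D] [InnerProductSpace ℝ D]
  [RKHS ℝ D (X × X) ℝ] {Ω : Type*} {mΩ : MeasurableSpace Ω} {P : Measure Ω} {ℱ : Filtration ℕ mΩ}
  {k : X → X → ℝ} {f : X → ℝ} {B lam δ : ℝ} {T : ℕ}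
  {z : ℕ → Ω → X × X} {y : ℕ → Ω → Bool} {M : ℕ → Ω → Finset X} {hhat : ℕ → Ω → D}

/-- The noise of round `r` is small, uniformly over all functions of the sampled points. -/
def SmallNoise (f : X → ℝ) (δ : ℝ) (T : ℕ) (z : ℕ → Ω → X × X) (y : ℕ → Ω → Bool) (r : ℕ)
    (ω : Ω) : Prop :=
  ∀ v : X × X → ℝ, ∑ i : Fin (roundLen T r), ((if y (roundStart T r + i) ω then 1 else 0) -
      prefProb f (z (roundStart T r + i) ω).1 (z (roundStart T r + i) ω).2) *
        v (z (roundStart T r + i) ω) ≤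
    √(4 / 5 * confLog (Fintype.card X) δ T * ∑ i : Fin (roundLen T r),
      v (z (roundStart T r + i) ω) ^ 2)

lemma IsMRLPFRun.sigma_sq_le [CompleteSpace D]
    (hrun : IsMRLPFRun P ℱ k f B lam δ T z y M hhat)
    (hD : HasKernel D (duelingKernel k)) (hlam : 0 < lam) {r : ℕ}
    (hr : r ∈ Finset.Icc 1 (numRounds T))
    (hlen : 2 * (Fintype.card X * Fintype.card X) ≤ roundLen T r) (ω : Ω) {x x' : X}
    (hx : x ∈ M r ω) (hx' : x' ∈ M r ω) :
    sigma (duelingKernel k) (lam * kappaRound f r)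
      (roundData T r (roundLen T r) fun t => z t ω) (x, x') ^ 2 ≤
      2 * (lam * kappaRound f r) * (Fintype.card X * Fintype.card X) / roundLen T r := by
  have hκ := four_le_kappaRound f r
  have h := sigma_sq_le_of_max hD (ρ := lam * kappaRound f r) (by positivity)
    (N := roundLen T r) (fun n => z (roundStart T r + n) ω) (x, x')
    (by rwa [Fintype.card_prod]) (fun n hn => hrun.select_max r hr n hn ω x hx x' hx')
  rw [Fintype.card_prod] at h
  exact_mod_cast h

/-- On the small noise event the optimal action stays active, and the active actions are close to
optimal. -/
theorem IsMRLPFRun.mem_and_gap_le [CompleteSpace D]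
    (hrun : IsMRLPFRun P ℱ k f B lam δ T z y M hhat)
    (hD : HasKernel D (duelingKernel k)) (hk4 : ∀ w, duelingKernel k w w ≤ 4) (hB : 0 < B)
    (hlam : 0 < lam) {κ : ℝ} (h6 : 6 ≤ κ) (hκ : kappa f ≤ κ) {m : ℕ}
    (hT : IsLargeHorizon (Fintype.card X) m B lam δ κ T) {h : D} (hh : ‖h‖ ≤ B)
    (hhf : ∀ w, h w = f w.1 - f w.2) {xstar : X} (hstar : ∀ x, f x ≤ f xstar) {ω : Ω}
    (hω : ∀ r ∈ Finset.Ico 1 (numRounds T), SmallNoise f δ T z y r ω) {r : ℕ}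
    (hr : r < numRounds T) :
    xstar ∈ M (r + 1) ω ∧ (1 ≤ r → ∀ x ∈ M (r + 1) ω, prefProb f xstar x - 1 / 2 ≤
      2 * beta f B lam δ T r *
        √(2 * (lam * κ) * (Fintype.card X * Fintype.card X) / fullLen T r)) := by
  have hT1 : 1 ≤ T := by linarith [hT.four_le]
  have hsT : 0 < √(T : ℝ) := Real.sqrt_pos.2 (by exact_mod_cast hT1)
  induction r with
  | zero => exact ⟨by simp [hrun.init], fun h => absurd h (by norm_num)⟩
  | succ r ih =>
    obtain ⟨ihs, ihg⟩ := ih (by omega)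
    set l := confLog (Fintype.card X) δ T with hl
    have hl1 : 1 ≤ l := hT.one_le_confLog
    have hrI : r + 1 ∈ Finset.Icc 1 (numRounds T) := by
      rw [Finset.mem_Icc]; omega
    have hlen : roundLen T (r + 1) = fullLen T (r + 1) := roundLen_eq_fullLen hr
    have hsqlen := sqrt_le_fullLen hT1 (show 1 ≤ r + 1 by omega)
    have hκ4 := four_le_kappaRound f (r + 1)
    have hσ : ∀ x ∈ M (r + 1) ω, ∀ x' ∈ M (r + 1) ω,
        sigma (duelingKernel k) (lam * kappaRound f (r + 1))
          (roundData T (r + 1) (roundLen T (r + 1)) fun t => z t ω) (x, x') ^ 2 ≤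
        2 * (lam * κ) * (Fintype.card X * Fintype.card X) / fullLen T (r + 1) := by
      intro x hx x' hx'
      have h1 : 2 * (Fintype.card X * Fintype.card X) ≤ roundLen T (r + 1) := by
        rw [hlen]; exact_mod_cast hT.sample.trans hsqlen
      refine (hrun.sigma_sq_le hD hlam hrI h1 ω hx hx').trans ?_
      rw [hlen]
      gcongr
      exact kappaRound_le h6 hκ _
    have hmem : ∀ i : Fin (roundLen T (r + 1)),
        (roundData T (r + 1) (roundLen T (r + 1)) (fun t => z t ω) i).1 ∈ M (r + 1) ω ∧
        (roundData T (r + 1) (roundLen T (r + 1)) (fun t => z t ω) i).2 ∈ M (r + 1) ω :=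
      fun i => hrun.select_mem (r + 1) hrI i i.2 ω
    have hderiv : ∀ x ∈ M (r + 1) ω, ∀ x' ∈ M (r + 1) ω,
        1 / kappaRound f (r + 1) ≤ deriv Real.sigmoid (f x - f x') := by
      intro x hx x' hx'
      rcases Nat.eq_zero_or_pos r with rfl | hr0
      · simpa [kappaRound] using inv_kappa_le f x x'
      · rw [kappaRound, if_neg (by omega), deriv_sigmoid_eq]
        set d := 2 * beta f B lam δ T r *
          √(2 * (lam * κ) * (Fintype.card X * Fintype.card X) / fullLen T r) with hd
        have hd2 : d ^ 2 ≤ 1 / 12 := by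
          refine le_trans ?_ hT.gap
          rw [hd, mul_pow, mul_pow, Real.sq_sqrt (by positivity)]
          have h2 := beta_le h6 hκ (B := B) hlam (by linarith : 0 ≤ l) r
          have h3 := beta_nonneg f (lam := lam) (δ := δ) hB T r
          have h4 := sqrt_le_fullLen hT1 hr0
          norm_num only
          gcongr
        have h1 := ihg hr0 x hx
        have h2 := ihg hr0 x' hx'
        have h3 : Real.sigmoid (f x - f x') ≤ prefProb f xstar x' :=
          Real.sigmoid_le (by linarith [hstar x])
        have h4 : Real.sigmoid (f x' - f x) ≤ prefProb f xstar x :=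
          Real.sigmoid_le (by linarith [hstar x'])
        rw [← neg_sub, Real.sigmoid_neg] at h4
        -- Optimality of `xstar` places the preference between two active actions within `d` of 1/2,
        -- from both sides.
        have h5 : (Real.sigmoid (f x - f x') - 1 / 2) ^ 2 ≤ d ^ 2 :=
          sq_le_sq' (by linarith) (by linarith)
        linarith
    have hconf : ∀ w, |Real.sigmoid (hhat (r + 1) ω w) - Real.sigmoid (h w)| ≤
        beta f B lam δ T (r + 1) * sigma (duelingKernel k) (lam * kappaRound f (r + 1))
          (roundData T (r + 1) (roundLen T (r + 1)) fun t => z t ω) w := by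
      intro w
      rw [beta_eq]
      refine abs_sigmoid_estimate_sub_le hD hk4 hB hlam hκ4 hl1 hT.bias hh
        (hrun.estimate (r + 1) hrI ω) (fun i => ?_) (fun v => ?_) (fun i => ?_) w
      · rw [hhf]
        exact hderiv _ (hmem i).1 _ (hmem i).2
      · have := hω (r + 1) (by rw [Finset.mem_Ico]; omega) v
        simp only [hhf]
        exact this
      · have h1 := hσ _ (hmem i).1 _ (hmem i).2
        have hK := consistencyConst_nonneg hB hlam (deriv_sigmoid_pos (2 * B + 1))
        have hκle := kappaRound_le h6 hκ (r + 1)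
        calc _ ≤ 2 * (lam * κ) * (Fintype.card X * Fintype.card X) / √T * (consistencyConst B lam
                (deriv Real.sigmoid (2 * B + 1)) * l ^ 3) := by
              refine mul_le_mul_of_nonneg_right (h1.trans ?_) (by positivity)
              gcongr
          _ ≤ (1 / (5 * κ)) ^ 2 := hT.consistency
          _ ≤ _ := by gcongr
    have hβ := beta_nonneg f (lam := lam) (δ := δ) hB T (r + 1)
    refine ⟨?_, fun _ x hx => ?_⟩
    · rw [hrun.update (r + 1) hrI]
      refine ⟨ihs, fun x' hx' => ?_⟩
      have h1 := (abs_le.1 (hconf (xstar, x'))).1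
      have h2 : 1 / 2 ≤ Real.sigmoid (h (xstar, x')) := by
        rw [hhf, one_div, ← Real.sigmoid_zero]
        exact Real.sigmoid_le (sub_nonneg.2 (hstar x'))
      linarith
    · rw [hrun.update (r + 1) hrI] at hx
      obtain ⟨hx1, hx2⟩ := hx
      -- The survivor `x` passed the test against the still active `xstar`; one βσ comes from the
      -- test and one from the confidence bound.
      have h1 := (abs_le.1 (hconf (x, xstar))).2
      have h2 := hx2 xstar ihs
      have h3 : Real.sigmoid (h (x, xstar)) = 1 - prefProb f xstar x := by
        rw [hhf, prefProb, ← Real.sigmoid_neg, neg_sub]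
      have h4 := Real.le_sqrt_of_sq_le (hσ x hx1 xstar ihs)
      have h5 := mul_le_mul_of_nonneg_left h4 hβ
      rw [h3] at h1
      linarith

/-- The first round costs at most its length. Afterwards the gap of order 1/√N_r multiplies a length
of about √(N_r T), and N_r cancels. The term 4/B rewrites the first cost as a multiple of β, using β
≥ B/4. -/
theorem IsMRLPFRun.regret_le [CompleteSpace D]
    (hrun : IsMRLPFRun P ℱ k f B lam δ T z y M hhat)
    (hD : HasKernel D (duelingKernel k)) (hk4 : ∀ w, duelingKernel k w w ≤ 4) (hB : 0 < B)
    (hlam : 0 < lam) {κ : ℝ} (h6 : 6 ≤ κ) (hκ : kappa f ≤ κ) {m : ℕ}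
    (hT : IsLargeHorizon (Fintype.card X) m B lam δ κ T) {h : D} (hh : ‖h‖ ≤ B)
    (hhf : ∀ w, h w = f w.1 - f w.2) {xstar : X} (hstar : ∀ x, f x ≤ f xstar) {ω : Ω}
    (hω : ∀ r ∈ Finset.Ico 1 (numRounds T), SmallNoise f δ T z y r ω) :
    regret f xstar T (fun t => z t ω) ≤ numRounds T * ((√T + 1) *
      (beta f B lam δ T (numRounds T) *
        (4 / B + 2 * κ * √(2 * (lam * κ) * (Fintype.card X * Fintype.card X))))) := by
  have hT1 : 1 ≤ T := by linarith [hT.four_le]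
  set β := beta f B lam δ T (numRounds T) with hβ
  set a := 2 * (lam * κ) * (Fintype.card X * Fintype.card X : ℝ) with ha
  have hl : 0 ≤ confLog (Fintype.card X) δ T := by linarith [hT.one_le_confLog]
  have hβB : B / 4 ≤ β := by
    rw [hβ, beta_eq]
    have := Real.sqrt_nonneg (kappaRound f (numRounds T) / lam * confLog (Fintype.card X) δ T)
    linarith
  have hβ0 : 0 < β := by linarith
  have ha0 : 0 ≤ a := by positivity
  rw [regret, sum_range_eq_sum_rounds hT1]
  refine (Finset.sum_le_card_nsmul _ _ ((√T + 1) * (β * (4 / B + 2 * κ * √a))) fun r hr => ?_).trans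
    (by rw [Finset.card_range, nsmul_eq_mul])
  have hr' := Finset.mem_range.1 hr
  rcases Nat.eq_zero_or_pos r with rfl | hr0
  · calc _ ≤ ∑ n ∈ Finset.range (roundLen T (0 + 1)), (1 : ℝ) := by
          refine Finset.sum_le_sum fun n _ => ?_
          have h1 := Real.sigmoid_le_one (f xstar - f (z (roundStart T (0 + 1) + n) ω).1)
          have h2 := Real.sigmoid_le_one (f xstar - f (z (roundStart T (0 + 1) + n) ω).2)
          unfold prefProb
          linarith
      _ = roundLen T 1 := by simp
      _ ≤ √T + 1 := le_trans (by exact_mod_cast roundLen_le_fullLen T 1) (fullLen_one_le T)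
      _ ≤ _ := by
          refine le_mul_of_one_le_right (by positivity) ?_
          have h3 : 1 ≤ β * (4 / B) := by
            rw [mul_div_assoc', le_div_iff₀ hB]; linarith
          have h4 : 0 ≤ β * (2 * κ * √a) := by positivity
          linarith
  · obtain ⟨-, hgap⟩ := hrun.mem_and_gap_le hD hk4 hB hlam h6 hκ hT hh hhf hstar hω hr'
    have hrI : r + 1 ∈ Finset.Icc 1 (numRounds T) := by rw [Finset.mem_Icc]; omega
    have hN : (1 : ℝ) ≤ fullLen T r := by exact_mod_cast one_le_fullLen hT1 hr0
    have hβr := beta_le_mul_beta h6 hκ (B := B) hB hlam hl r hT.two_le_numRounds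
    have hβr0 := beta_nonneg f (lam := lam) (δ := δ) hB T r
    calc _ ≤ ∑ n ∈ Finset.range (roundLen T (r + 1)),
            2 * beta f B lam δ T r * √(a / fullLen T r) := by
          refine Finset.sum_le_sum fun n hn => ?_
          have hm := hrun.select_mem (r + 1) hrI n (Finset.mem_range.1 hn) ω
          have h1 := hgap hr0 _ hm.1
          have h2 := hgap hr0 _ hm.2
          linarith
      _ = roundLen T (r + 1) * (2 * beta f B lam δ T r * √(a / fullLen T r)) := by
          rw [Finset.sum_const, Finset.card_range, nsmul_eq_mul]
      _ ≤ (√(fullLen T r) * √T + 1) * (2 * (κ * β) * √(a / fullLen T r)) := by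
          gcongr
          exact le_trans (by exact_mod_cast roundLen_le_fullLen T (r + 1)) (fullLen_succ_le T hr0)
      _ = (√T + 1 / √(fullLen T r)) * (2 * (κ * β) * √a) := by
          have : √(fullLen T r : ℝ) ≠ 0 := (Real.sqrt_pos.2 (by linarith)).ne'
          rw [Real.sqrt_div' _ (Nat.cast_nonneg _)]
          field_simp
      _ ≤ (√T + 1) * (2 * (κ * β) * √a) := by
          gcongr
          rw [div_le_one (Real.sqrt_pos.2 (by linarith))]
          exact Real.one_le_sqrt.2 hN
      _ ≤ _ := by
          refine mul_le_mul_of_nonneg_left ?_ (by positivity)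
          have : 0 ≤ β * (4 / B) := by positivity
          linarith

theorem IsMRLPFRun.measure_not_smallNoise_le [IsProbabilityMeasure P]
    (hrun : IsMRLPFRun P ℱ k f B lam δ T z y M hhat) (hδ : δ ∈ Set.Ioo (0 : ℝ) 1) {κ : ℝ}
    {F : Finset (X × X → ℝ)} (hF1 : ∀ a ∈ F, ∑ w, a w ^ 2 ≤ 1)
    (hF : ∀ g : X × X → ℝ, ∃ a ∈ F, 9 / 10 * √(∑ w, g w ^ 2) ≤ ∑ w, a w * g w)
    (hT : IsLargeHorizon (Fintype.card X) F.card B lam δ κ T) :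
    P {ω | ¬ ∀ r ∈ Finset.Ico 1 (numRounds T), SmallNoise f δ T z y r ω} ≤ ENNReal.ofReal δ := by
  set l := confLog (Fintype.card X) δ T with hl
  have hl1 : 1 ≤ l := hT.one_le_confLog
  -- The last round is left out: the active set computed from its feedback is never played.
  have hround : ∀ r ∈ Finset.Ico 1 (numRounds T), P {ω | ¬ SmallNoise f δ T z y r ω} ≤
      ENNReal.ofReal (F.card * Real.exp (-(81 / 50 * (4 / 5 * l)))) := by
    intro r hr
    have hrI : r ∈ Finset.Icc 1 (numRounds T) := by
      rw [Finset.mem_Ico] at hr; rw [Finset.mem_Icc]; omega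
    have hlt : ∀ n < roundLen T r, roundStart T r + n < T := fun n hn => by
      have := roundStart_add_roundLen_le T r
      omega
    exact measure_exists_noise_gt_le hF1 hF (P := P) (m := fun n => ℱ (roundStart T r + n))
      (fun i j hij => ℱ.mono (by omega)) (fun n => ℱ.le _) (N := roundLen T r)
      (z := fun n => z (roundStart T r + n)) (b := fun n => y (roundStart T r + n))
      (p := fun w => prefProb f w.1 w.2)
      (fun w => ⟨Real.sigmoid_nonneg _, Real.sigmoid_le_one _⟩)
      (fun n hn w => hrun.select_meas r hrI n hn w)
      (fun n hn => hrun.feedback_meas _ (hlt n hn))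
      (fun n hn => hrun.feedback_law _ (hlt n hn)) (by positivity)
  have hsub : {ω | ¬ ∀ r ∈ Finset.Ico 1 (numRounds T), SmallNoise f δ T z y r ω} ⊆
      ⋃ r ∈ Finset.Ico 1 (numRounds T), {ω | ¬ SmallNoise f δ T z y r ω} := by
    intro ω hω
    simpa [and_assoc] using hω
  refine (measure_mono hsub).trans ((measure_biUnion_finset_le _ _).trans
    ((Finset.sum_le_sum hround).trans ?_))
  rw [Finset.sum_const, nsmul_eq_mul, ← ENNReal.ofReal_natCast,
    ← ENNReal.ofReal_mul (Nat.cast_nonneg _), Nat.card_Ico]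
  refine ENNReal.ofReal_le_ofReal ?_
  have hR : (0 : ℝ) < numRounds T := by
    have := hT.two_le_numRounds
    exact_mod_cast (by omega : 0 < numRounds T)
  have hN : (1 : ℝ) ≤ Fintype.card X := by exact_mod_cast Fintype.card_pos
  have hδ0 := hδ.1
  have hexp : Real.exp (-l) = δ / (2 * numRounds T * Fintype.card X) := by
    rw [hl, confLog, Real.exp_neg, Real.exp_log (by positivity), inv_div]
  -- The exponent 81/50 · 4/5 exceeds 5/4, which leaves room for the size of the norming set, at
  -- most exp(l/4).
  calc ((numRounds T - 1 : ℕ) : ℝ) * (F.card * Real.exp (-(81 / 50 * (4 / 5 * l))))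
      ≤ numRounds T * (Real.exp (l / 4) * Real.exp (-(81 / 50 * (4 / 5 * l)))) := by
        gcongr
        · omega
        · exact hT.norming
    _ ≤ numRounds T * Real.exp (-l) := by
        rw [← Real.exp_add]
        gcongr
        linarith
    _ = δ / (2 * Fintype.card X) := by rw [hexp]; field_simp
    _ ≤ δ := div_le_self hδ0.le (by linarith)

end Run

/-! ### Growth and simplification of the regret bound -/

section Bound

lemma constC_pos {lam : ℝ} (hlam : 0 < lam) : 0 < constC lam := by
  have : 0 < Real.log (1 + 4 * (6 * lam)⁻¹) :=
    Real.log_pos (by linarith [show 0 < 4 * (6 * lam)⁻¹ by positivity])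
  unfold constC
  positivity

lemma eventually_le_constC_mul_sqrt_infoGain {S : Type*} [Finite S] {q : S → S → ℝ} {w : S}
    (hw : 0 < q w w) {lam : ℝ} (hlam : 0 < lam) (G : ℝ) :
    ∀ᶠ T in atTop, G ≤ 2 * constC lam * √(infoGain q (4 * lam) T) := by
  have h : Tendsto (fun T : ℕ => 1 / 2 * Real.log (1 + T * ((4 * lam)⁻¹ * q w w))) atTop atTop := by
    refine (Real.tendsto_log_atTop.comp ?_).const_mul_atTop (by norm_num)
    refine tendsto_atTop_add_const_left _ _ ?_
    exact tendsto_natCast_atTop_atTop.atTop_mul_const (by positivity)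
  have h2 : Tendsto (fun T => √(infoGain q (4 * lam) T)) atTop atTop :=
    Real.tendsto_sqrt_atTop.comp (tendsto_atTop_mono (fun T => le_infoGain q _ T w) h)
  exact (h2.const_mul_atTop (by linarith [constC_pos hlam] : 0 < 2 * constC lam)
    ).eventually_ge_atTop G

lemma eventually_numRounds_mul_confLog_le {N : ℕ} (hN : 0 < N) {δ : ℝ}
    (hδ : δ ∈ Set.Ioo (0 : ℝ) 1) :
    ∀ᶠ T : ℕ in atTop, numRounds T * confLog N δ T ≤ √(Real.log (2 * N / δ)) * Real.log T := by
  have hN' : (1 : ℝ) ≤ N := by exact_mod_cast hN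
  have hpos : 0 < √(Real.log (2 * N / δ)) := by
    refine Real.sqrt_pos.2 (Real.log_pos ?_)
    rw [lt_div_iff₀ hδ.1]
    linarith [hδ.2]
  filter_upwards [(tendsto_numRounds_mul_confLog_div_log hN hδ).eventually (gt_mem_nhds hpos),
    eventually_ge_atTop 2] with T h1 h2
  have h3 : 0 < Real.log T := Real.log_pos (by exact_mod_cast h2)
  rw [div_lt_iff₀ h3] at h1
  exact h1.le

variable {X : Type*} [Fintype X] [Nonempty X]

lemma regretBound_nonneg (k : X → X → ℝ) (f : X → ℝ) {B lam : ℝ} (δ : ℝ) (T : ℕ) (hB : 0 < B)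
    (hlam : 0 < lam) : 0 ≤ regretBound k f B lam δ T := by
  have := beta_nonneg f (lam := lam) (δ := δ) hB T (numRounds T)
  have := constC_pos hlam
  unfold regretBound
  positivity

lemma regretBound_le (k : X → X → ℝ) (f : X → ℝ) {B lam δ : ℝ} {T : ℕ} (hB : 0 < B)
    (hlam : 0 < lam) (hT : 1 ≤ T) (hR : 2 ≤ numRounds T)
    (hl : 1 ≤ confLog (Fintype.card X) δ T)
    (h : numRounds T * confLog (Fintype.card X) δ T ≤
      √(Real.log (2 * (Fintype.card X : ℝ) / δ)) * Real.log T) :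
    regretBound k f B lam δ T ≤ constC lam * (B + √(6 / lam)) *
      √(Real.log (2 * (Fintype.card X : ℝ) / δ)) * Real.log T *
        √(infoGain (duelingKernel k) (4 * lam) T * T) := by
  have hC := constC_pos hlam
  rw [Real.sqrt_mul' _ (Nat.cast_nonneg T), regretBound, beta_eq, kappaRound, if_neg (by omega),
    Real.sqrt_mul (by positivity)]
  set l := confLog (Fintype.card X) δ T
  set Γ := √(infoGain (duelingKernel k) (4 * lam) T)
  have hs : √l ≤ l := by
    rw [Real.sqrt_le_iff]; exact ⟨by linarith, by nlinarith⟩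
  have h1 : B + √(6 / lam) * √l ≤ (B + √(6 / lam)) * l := by
    have := mul_le_mul_of_nonneg_left hs (Real.sqrt_nonneg (6 / lam))
    nlinarith
  have h2 : √(T : ℝ) + 1 ≤ 2 * √T := by
    have : 1 ≤ √(T : ℝ) := Real.one_le_sqrt.2 (by exact_mod_cast hT)
    linarith
  have hΓ : 0 ≤ Γ := Real.sqrt_nonneg _
  calc 2 * constC lam * numRounds T * (1 / 4 * (B + √(6 / lam) * √l)) * Γ * (√T + 1)
      ≤ 2 * constC lam * numRounds T * (1 / 4 * ((B + √(6 / lam)) * l)) * Γ * (2 * √T) := by gcongr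
    _ = constC lam * (B + √(6 / lam)) * (numRounds T * l) * (Γ * √T) := by ring
    _ ≤ constC lam * (B + √(6 / lam)) *
        (√(Real.log (2 * (Fintype.card X : ℝ) / δ)) * Real.log T) * (Γ * √T) := by gcongr
    _ = _ := by ring

end Bound

end BOHF

/-! ### Choice of the threshold and conclusion -/

theorem theorem1 {X : Type*} [Fintype X] [DecidableEq X] [Nonempty X]
    {H : Type*} [NormedAddCommGroup H] [InnerProductSpace ℝ H] [CompleteSpace H] [RKHS ℝ H X ℝ]
    {D : Type*} [NormedAddCommGroup D] [InnerProductSpace ℝ D] [CompleteSpace D]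
    [RKHS ℝ D (X × X) ℝ]
    (k : X → X → ℝ) (hkH : BOHF.HasKernel H k) (hkD : BOHF.HasKernel D (BOHF.duelingKernel k))
    (hk1 : ∀ x x', k x x' ≤ 1)
    (B lam δ : ℝ) (hB : 0 < B) (hlam : 0 < lam) (hδ : δ ∈ Set.Ioo (0 : ℝ) 1) :
    ∃ T₀ : ℕ, 0 < T₀ ∧
      ∀ f : H, ‖f‖ ≤ B → ∀ xstar : X, (∀ x, f x ≤ f xstar) → ∀ T : ℕ, T₀ ≤ T →
        -- number of rounds
        ((BOHF.numRounds T : ℤ) ≤ ⌈Real.logb 2 (Real.logb 2 (T : ℝ))⌉ + 1) ∧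
        -- the regret bound holds with probability at least `1 - δ`
        (∀ (Ω : Type*) (mΩ : MeasurableSpace Ω) (P : MeasureTheory.Measure Ω)
          (_ : MeasureTheory.IsProbabilityMeasure P) (ℱ : MeasureTheory.Filtration ℕ mΩ)
          (z : ℕ → Ω → X × X) (y : ℕ → Ω → Bool) (M : ℕ → Ω → Finset X) (hhat : ℕ → Ω → D),
          BOHF.IsMRLPFRun P ℱ k (fun x => f x) B lam δ T z y M hhat →
            ENNReal.ofReal (1 - δ) ≤
              P {ω | BOHF.regret (fun x => f x) xstar T (fun t => z t ω) ≤
                BOHF.regretBound k (fun x => f x) B lam δ T}) ∧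
        -- the bound is of the order of `√(Γ T)` up to a logarithm, with a constant free of `κ`
        BOHF.regretBound k (fun x => f x) B lam δ T ≤
          BOHF.constC lam * (B + √(6 / lam)) * √(Real.log (2 * (Fintype.card X : ℝ) / δ)) *
            Real.log (T : ℝ) *
            √(BOHF.infoGain (BOHF.duelingKernel k) (4 * lam) T * (T : ℝ)) := by
  obtain ⟨F, hF1, hF⟩ := BOHF.exists_norming_finset (X × X)
  have hk4 := BOHF.duelingKernel_diag_le hkH hk1
  -- Utility differences are at most 2B in absolute value, so this bounds all curvature constants at
  -- once.
  set κ := max 6 (1 / deriv Real.sigmoid (2 * B)) with hκdef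
  have h6 : 6 ≤ κ := le_max_left _ _
  have hcard : 0 < Fintype.card X := Fintype.card_pos
  have hgain : ∀ᶠ T in Filter.atTop, ∀ w : X × X, 0 < BOHF.duelingKernel k w w →
      4 / B + 2 * κ * √(2 * (lam * κ) * (Fintype.card X * Fintype.card X)) ≤
        2 * BOHF.constC lam * √(BOHF.infoGain (BOHF.duelingKernel k) (4 * lam) T) := by
    refine Filter.eventually_all.2 fun w => ?_
    by_cases hw : 0 < BOHF.duelingKernel k w w
    · exact (BOHF.eventually_le_constC_mul_sqrt_infoGain hw hlam _).mono fun T hT _ => hT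
    · exact Filter.Eventually.of_forall fun T h => absurd h hw
  obtain ⟨T₁, hT₁⟩ := Filter.eventually_atTop.1
    (((BOHF.eventually_isLargeHorizon hcard F.card hB hlam hδ (by linarith : 0 < κ)).and
      hgain).and (BOHF.eventually_numRounds_mul_confLog_le hcard hδ))
  refine ⟨T₁ + 1, Nat.succ_pos _, fun f hf xstar hstar T hT => ?_⟩
  obtain ⟨⟨hlarge, hΓ⟩, hlog⟩ := hT₁ T (by omega)
  have hT1 : 1 ≤ T := by omega
  refine ⟨BOHF.numRounds_le hlarge.four_le, ?_, BOHF.regretBound_le k _ hB hlam hT1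
    hlarge.two_le_numRounds hlarge.one_le_confLog hlog⟩
  intro Ω mΩ P _ ℱ z y M hhat hrun
  obtain ⟨h, hh, hhf⟩ := BOHF.exists_dueling_function hkH hkD f
  have hh' : ‖h‖ ≤ B := hh.trans hf
  have hκ : BOHF.kappa (fun x => f x) ≤ κ := by
    refine (BOHF.kappa_le fun x x' => ?_).trans (le_max_right _ _)
    have h1 : ‖BOHF.feature D (x, x')‖ ≤ 2 := by
      have := hk4 (x, x')
      rw [hkD.diag] at this
      nlinarith [norm_nonneg (BOHF.feature D (x, x'))]
    have h2 := BOHF.abs_apply_le h (x, x')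
    rw [hhf] at h2
    refine h2.trans ?_
    nlinarith [norm_nonneg h, norm_nonneg (BOHF.feature D (x, x'))]
  have hgood : {ω | ∀ r ∈ Finset.Ico 1 (BOHF.numRounds T),
      BOHF.SmallNoise (fun x => f x) δ T z y r ω} ⊆
      {ω | BOHF.regret (fun x => f x) xstar T (fun t => z t ω) ≤
        BOHF.regretBound k (fun x => f x) B lam δ T} := by
    intro ω hω
    rw [Set.mem_ofPred_eq]
    -- If the dueling kernel vanishes on the diagonal, Γ need not grow, but then `f` is constant.
    by_cases hq : ∃ w, 0 < BOHF.duelingKernel k w w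
    · obtain ⟨w, hw⟩ := hq
      refine (hrun.regret_le hkD hk4 hB hlam h6 hκ hlarge hh' hhf hstar hω).trans ?_
      have hβ := BOHF.beta_nonneg (fun x => f x) (lam := lam) (δ := δ) hB T (BOHF.numRounds T)
      calc _ ≤ BOHF.numRounds T * ((√(T : ℝ) + 1) *
            (BOHF.beta (fun x => f x) B lam δ T (BOHF.numRounds T) *
              (2 * BOHF.constC lam *
                √(BOHF.infoGain (BOHF.duelingKernel k) (4 * lam) T)))) := by
            gcongr
            exact hΓ w hw
        _ = _ := by rw [BOHF.regretBound]; ring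
    · push Not at hq
      refine le_trans (le_of_eq ?_) (BOHF.regretBound_nonneg k _ δ T hB hlam)
      have hconst : ∀ x x', f x = f x' := fun x x' =>
        BOHF.apply_sub_eq_zero_of_diag hkH f x x'
          (le_antisymm (hq _) (by rw [hkD.diag]; positivity))
      refine Finset.sum_eq_zero fun t _ => ?_
      rw [BOHF.prefProb, BOHF.prefProb, hconst xstar (z t ω).1, hconst (z t ω).1 (z t ω).2]
      simp
      norm_num
  refine le_trans ?_ (MeasureTheory.measure_mono hgood)
  have hbad := hrun.measure_not_smallNoise_le hδ hF1 hF hlarge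
  -- Subadditivity is used instead of complements, so measurability of the good event is not needed.
  have hone : 1 ≤ P {ω | ∀ r ∈ Finset.Ico 1 (BOHF.numRounds T),
      BOHF.SmallNoise (fun x => f x) δ T z y r ω} + ENNReal.ofReal δ := by
    rw [← MeasureTheory.measure_univ (μ := P)]
    refine le_trans ?_ ((MeasureTheory.measure_union_le _ _).trans (add_le_add le_rfl hbad))
    exact MeasureTheory.measure_mono fun ω _ => or_not
  rw [ENNReal.ofReal_sub _ hδ.1.le, ENNReal.ofReal_one]
  exact tsub_le_iff_right.2 hone
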